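/- Let $G$ be a compact (Hausdorff) abelian group with normalized Haar measure, and let $L_1=L_1(G)$ be its convolution algebra. A \emph{quasi Banach $L_1$-module} is a complete complex quasinormed space $Z$ with a jointly continuous bilinear multiplication $L_1\times Z\to Z$ such that $(a*b)z=a(bz)$; a \emph{homomorphism} is a continuous linear map commuting with the multiplications. An \emph{extension} of $X$ by $Y$ is a short exact sequence $0\to Y\xrightarrow{\imath} Z\xrightarrow{\pi} X\to 0$ of quasi Banach $L_1$-modules and homomorphisms; it is \emph{trivial} if there is a homomorphism $u:Z\to Y\oplus X$ with $u(\imath y)=(y,0)$ for all $y\in Y$ and with second component equal to $\pi$ (that is, if it is equivalent to the direct sum extension). One writes $\operatorname{Ext}_{L_1}(X,Y)=0$ if every extension of $X$ by $Y$ is trivial. The spaces $L_p(G)$ ($1\le p\le\infty$) and $C(G)$ are $L_1$-modules under convolution, $(a*f)(x)=\int_G a(xy^{-1})f(y)\,dy$. The dual $V^*$ of a right quasinormed $L_1$-module $V$ is a left module under $\langle a\varphi,v\rangle=\langle\varphi,va\rangle$; such modules are called dual modules. Then $\operatorname{Ext}_{L_1}(L_1,Y)=0$ in each of the following cases: (1)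 $Y=V^*$ is a dual module; (2) $Y=L_p(G)$ with $1<p\le\infty$; (3) $Y=L_1(G)$; (4) $Y=C(G)$. -/

import Mathlib

open MeasureTheory Filter Topology TopologicalSpace
open scoped ENNReal

noncomputable section

/-! ### Quasinormed spaces -/

/-- `q` is a quasinorm on the complex vector space `E`. -/
structure IsQuasiNorm {E : Type*} [AddCommGroup E] [Module ℂ E] (q : E → ℝ) : Prop where
  nonneg : ∀ x, 0 ≤ q x
  eq_zero_iff : ∀ x, q x = 0 ↔ x = 0
  map_smul : ∀ (c : ℂ) (x : E), q (c • x) = ‖c‖ * q x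
  add_le : ∃ K : ℝ, ∀ x y, q (x + y) ≤ K * (q x + q y)

/-- The topology of the complex vector space `E` is given by a quasinorm. -/
class QuasiNormedSpace (E : Type*) [AddCommGroup E] [Module ℂ E] [TopologicalSpace E] :
    Prop where
  exists_quasiNorm : ∃ q : E → ℝ, IsQuasiNorm q ∧
    ∀ x : E, (𝓝 x).HasBasis (fun ε : ℝ => 0 < ε) (fun ε => {y | q (y - x) < ε})

/-- Every normed space is a quasinormed space. -/
instance (priority := 100) NormedSpace.toQuasiNormedSpace (E : Type*) [NormedAddCommGroup E]
    [NormedSpace ℂ E] : QuasiNormedSpace E where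
  exists_quasiNorm := by
    refine ⟨fun x => ‖x‖, ⟨fun x => norm_nonneg x, fun x => norm_eq_zero, norm_smul,
      1, fun x y => by simpa using norm_add_le x y⟩, fun x => ?_⟩
    have h := Metric.nhds_basis_ball (x := x)
    have h' : Metric.ball x = fun ε : ℝ => {y | ‖y - x‖ < ε} := by
      funext ε
      ext y
      simp [dist_eq_norm]
    rwa [h'] at h

/-! ### Convolution on a compact abelian group -/

section Convolution

variable (G : Type*) [CommGroup G] [TopologicalSpace G] [IsTopologicalGroup G] [CompactSpace G]
  [T2Space G] [MeasurableSpace G] [BorelSpace G]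

/-- The normalized Haar measure of the compact group `G`. -/
abbrev haarProb : Measure G := Measure.haarMeasure (⊤ : PositiveCompacts G)

instance isProbabilityMeasure_haarProb : IsProbabilityMeasure (haarProb G) :=
  ⟨by simpa using Measure.haarMeasure_self (K₀ := (⊤ : PositiveCompacts G))⟩

variable {G}

/-- The convolution `(a * f)(x) = ∫ a(x y⁻¹) f(y) dy`. -/
def convFun (a f : G → ℂ) (x : G) : ℂ := ∫ y, a (x * y⁻¹) * f y ∂(haarProb G)

theorem measurePreserving_mul_inv (x : G) :
    MeasurePreserving (fun y => x * y⁻¹) (haarProb G) (haarProb G) := by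
  simpa [div_eq_mul_inv] using Measure.measurePreserving_div_left (haarProb G) x

theorem convFun_congr {a a' f f' : G → ℂ} (ha : a =ᵐ[haarProb G] a')
    (hf : f =ᵐ[haarProb G] f') : convFun a f = convFun a' f' := by
  funext x
  refine integral_congr_ae ?_
  filter_upwards [(measurePreserving_mul_inv x).quasiMeasurePreserving.ae ha, hf] with y h1 h2
  rw [h1, h2]

/-- An integrable function on `G` has a representative `b` for which `b (x * y⁻¹)` is measurable
for the product `σ`-algebra of `G × G` (which can be smaller than the Borel one). -/
theorem exists_good_representative {a : G → ℂ} (ha : Integrable a (haarProb G)) :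
    ∃ b : G → ℂ, a =ᵐ[haarProb G] b ∧ Measurable fun p : G × G => b (p.1 * p.2⁻¹) := by
  have h1 : ∀ n : ℕ, ∃ g : G → ℂ, Continuous g ∧
      ∫⁻ x, ‖a x - g x‖ₑ ∂(haarProb G) ≤ ENNReal.ofReal ((1 / 2) ^ n) := by
    intro n
    obtain ⟨g, -, h, hg, hgi⟩ := ha.exists_hasCompactSupport_integral_sub_le
      (ε := (1 / 2) ^ n) (by positivity)
    refine ⟨g, hg, ?_⟩
    have h' := ofReal_integral_norm_eq_lintegral_enorm (ha.sub hgi)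
    simp only [Pi.sub_apply] at h'
    rw [← h']
    exact ENNReal.ofReal_le_ofReal h
  choose u hu hu' using h1
  have h2 : ∀ᵐ x ∂(haarProb G), Tendsto (fun n => u n x) atTop (𝓝 (a x)) := by
    have hm : ∀ n, AEMeasurable (fun x => ‖a x - u n x‖ₑ) (haarProb G) := fun n =>
      (ha.1.sub (hu n).aestronglyMeasurable).enorm
    have hfin : ∫⁻ x, ∑' n, ‖a x - u n x‖ₑ ∂(haarProb G) ≠ ∞ := by
      rw [lintegral_tsum hm]
      refine ne_top_of_le_ne_top ?_ (ENNReal.tsum_le_tsum hu')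
      rw [← ENNReal.ofReal_tsum_of_nonneg (fun n => by positivity) summable_geometric_two]
      exact ENNReal.ofReal_ne_top
    filter_upwards [ae_lt_top' (AEMeasurable.tsum hm) hfin] with x hx
    have h3 := ENNReal.tendsto_atTop_zero_of_tsum_ne_top hx.ne
    rw [tendsto_iff_edist_tendsto_0]
    simpa only [edist_comm, edist_eq_enorm_sub] using h3
  have hmeas : ∀ n, StronglyMeasurable fun p : G × G => u n (p.1 * p.2⁻¹) := fun n =>
    (HasCompactSupport.of_compactSpace _).stronglyMeasurable_of_prod
      ((hu n).comp (continuous_fst.mul continuous_snd.inv))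
  refine ⟨fun x => limUnder atTop fun n => u n x, ?_, ?_⟩
  · filter_upwards [h2] with x hx
    exact hx.limUnder_eq.symm
  · exact (StronglyMeasurable.limUnder (l := atTop) hmeas).measurable

theorem memLp_convFun {p : ℝ≥0∞} (hp : 1 ≤ p) {a f : G → ℂ} (ha : MemLp a 1 (haarProb G))
    (hf : MemLp f p (haarProb G)) : MemLp (convFun a f) p (haarProb G) := by
  obtain ⟨b, hab, hb⟩ := exists_good_representative (memLp_one_iff_integrable.1 ha)
  have hbm : Measurable b := by
    have h := hb.comp (measurable_prodMk_right (y := (1 : G)))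
    simpa [Function.comp_def] using h
  have hbi : Integrable b (haarProb G) := (memLp_one_iff_integrable.1 ha).congr hab
  obtain ⟨g, hg, hfg⟩ := hf.1
  rw [convFun_congr hab hfg]
  replace hf : MemLp g p (haarProb G) := hf.ae_eq hfg
  have hgm : Measurable g := hg.measurable
  have hbx : ∀ x : G, Measurable fun y : G => b (x * y⁻¹) := fun x =>
    hb.comp (measurable_prodMk_left (x := x))
  have hmeas : AEStronglyMeasurable (convFun b g) (haarProb G) :=
    ((hb.mul (hgm.comp measurable_snd)).stronglyMeasurable.integral_prod_right'
      (ν := haarProb G)).aestronglyMeasurable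
  rcases eq_or_ne p ∞ with rfl | hp'
  · have hM : ∀ᵐ y ∂(haarProb G), ‖g y‖ ≤ (eLpNormEssSup g (haarProb G)).toReal := by
      have h1 : eLpNormEssSup g (haarProb G) ≠ ∞ := by simpa using hf.2.ne
      filter_upwards [ae_le_eLpNormEssSup (f := g) (μ := haarProb G)] with y hy
      simpa using (ENNReal.toReal_le_toReal (by simp) h1).2 hy
    refine memLp_top_of_bound hmeas
      ((∫ y, ‖b y‖ ∂(haarProb G)) * (eLpNormEssSup g (haarProb G)).toReal)
      (Eventually.of_forall fun x => ?_)
    have h2 : Integrable (fun y => ‖b (x * y⁻¹)‖) (haarProb G) :=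
      ((measurePreserving_mul_inv x).integrable_comp_of_integrable hbi).norm
    have h3 : ∫ y, ‖b (x * y⁻¹)‖ ∂(haarProb G) = ∫ y, ‖b y‖ ∂(haarProb G) := by
      simpa [div_eq_mul_inv] using
        integral_div_left_eq_self (fun y => ‖b y‖) (haarProb G) x
    rw [← h3, ← integral_mul_const]
    refine norm_integral_le_of_norm_le (h2.mul_const _) ?_
    filter_upwards [hM] with y hy
    rw [norm_mul]
    gcongr
  · have hp0 : p ≠ 0 := (zero_lt_one.trans_le hp).ne'
    have hpr : 0 < p.toReal := ENNReal.toReal_pos hp0 hp'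
    refine ⟨hmeas, (eLpNorm_lt_top_iff_lintegral_rpow_enorm_lt_top hp0 hp').2 ?_⟩
    set A : ℝ≥0∞ := ∫⁻ y, ‖b y‖ₑ ∂(haarProb G) with hA
    have hAt : A < ∞ := hbi.2
    have hAx : ∀ x : G, ∫⁻ y, ‖b (x * y⁻¹)‖ₑ ∂(haarProb G) = A := fun x =>
      (measurePreserving_mul_inv x).lintegral_comp hbm.enorm
    have hAy : ∀ y : G, ∫⁻ x, ‖b (x * y⁻¹)‖ₑ ∂(haarProb G) = A := fun y =>
      lintegral_mul_right_eq_self (μ := haarProb G) (fun x => ‖b x‖ₑ) y⁻¹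
    have key : ∀ x : G, ‖convFun b g x‖ₑ ^ p.toReal ≤
        (∫⁻ y, ‖b (x * y⁻¹)‖ₑ * ‖g y‖ₑ ^ p.toReal ∂(haarProb G)) *
          (A ^ (1 - 1 / p.toReal)) ^ p.toReal := by
      intro x
      set ν : Measure G := (haarProb G).withDensity fun y => ‖b (x * y⁻¹)‖ₑ with hν
      have h1 : ‖convFun b g x‖ₑ ≤ eLpNorm g 1 ν := by
        rw [eLpNorm_one_eq_lintegral_enorm, hν,
          lintegral_withDensity_eq_lintegral_mul _ (hbx x).enorm hgm.enorm]
        refine (enorm_integral_le_lintegral_enorm _).trans_eq ?_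
        simp [enorm_mul]
      have h2 := eLpNorm_le_eLpNorm_mul_rpow_measure_univ (μ := ν) hp
        hgm.stronglyMeasurable.aestronglyMeasurable
      have h3 : ν Set.univ = A := by
        rw [hν, withDensity_apply _ MeasurableSet.univ, Measure.restrict_univ, hAx]
      have h4 : eLpNorm g p ν ^ p.toReal =
          ∫⁻ y, ‖b (x * y⁻¹)‖ₑ * ‖g y‖ₑ ^ p.toReal ∂(haarProb G) := by
        rw [eLpNorm_eq_lintegral_rpow_enorm_toReal hp0 hp', ← ENNReal.rpow_mul,
          one_div_mul_cancel hpr.ne', ENNReal.rpow_one, hν,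
          lintegral_withDensity_eq_lintegral_mul _ (hbx x).enorm (hgm.enorm.pow_const _)]
        rfl
      rw [h3] at h2
      calc ‖convFun b g x‖ₑ ^ p.toReal
          ≤ (eLpNorm g p ν * A ^ (1 - 1 / p.toReal)) ^ p.toReal := by
            refine ENNReal.rpow_le_rpow (h1.trans (h2.trans_eq ?_)) hpr.le
            simp
        _ = _ := by rw [ENNReal.mul_rpow_of_nonneg _ _ hpr.le, h4]
    have hC : (A ^ (1 - 1 / p.toReal)) ^ p.toReal ≠ ∞ := by
      have : 0 ≤ 1 - 1 / p.toReal := by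
        have h1 : 1 ≤ p.toReal := by
          simpa using (ENNReal.toReal_le_toReal (by simp) hp').2 hp
        rw [sub_nonneg, div_le_one hpr]
        exact h1
      exact ENNReal.rpow_ne_top_of_nonneg hpr.le (ENNReal.rpow_ne_top_of_nonneg this hAt.ne)
    refine (lintegral_mono key).trans_lt ?_
    rw [lintegral_mul_const' _ _ hC, lintegral_lintegral_swap]
    · have h5 : ∀ y : G, ∫⁻ x, ‖b (x * y⁻¹)‖ₑ * ‖g y‖ₑ ^ p.toReal ∂(haarProb G) =
          A * ‖g y‖ₑ ^ p.toReal := by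
        intro y
        have h6 : Measurable fun x : G => ‖b (x * y⁻¹)‖ₑ :=
          (hbm.comp (measurable_mul_const y⁻¹)).enorm
        rw [lintegral_mul_const _ h6, hAy]
      simp_rw [h5]
      rw [lintegral_const_mul' _ _ hAt.ne]
      exact ENNReal.mul_lt_top (ENNReal.mul_lt_top hAt
        ((eLpNorm_lt_top_iff_lintegral_rpow_enorm_lt_top hp0 hp').1 hf.2)) hC.lt_top
    · exact (hb.enorm.mul ((hgm.comp measurable_snd).enorm.pow_const _)).aemeasurable

theorem continuous_convFun {a f : G → ℂ} (ha : MemLp a 1 (haarProb G)) (hf : Continuous f) :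
    Continuous (convFun a f) := by
  have hai := memLp_one_iff_integrable.1 ha
  have hint : ∀ g : C(G, ℂ), Integrable (fun y => a y * g y) (haarProb G) := fun g =>
    hai.mul_bdd (c := ‖g‖) g.continuous.aestronglyMeasurable
      (Eventually.of_forall g.norm_coe_le_norm)
  let L : C(G, ℂ) →L[ℂ] ℂ := LinearMap.mkContinuous
    { toFun := fun g => ∫ y, a y * g y ∂(haarProb G)
      map_add' := fun g h => by
        simp only [ContinuousMap.add_apply, mul_add]
        exact integral_add (hint g) (hint h)
      map_smul' := fun c g => by
        simp only [ContinuousMap.smul_apply, smul_eq_mul, mul_left_comm _ c, RingHom.id_apply]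
        exact integral_const_mul c _ }
    (∫ y, ‖a y‖ ∂(haarProb G)) fun g => by
      rw [← integral_mul_const]
      refine norm_integral_le_of_norm_le (hai.norm.mul_const _)
        (Eventually.of_forall fun y => ?_)
      rw [norm_mul]
      gcongr
      exact g.norm_coe_le_norm y
  let F : C(G × G, ℂ) := ⟨fun q => f (q.2⁻¹ * q.1), by fun_prop⟩
  have h : convFun a f = fun x => L (F.curry x) := by
    funext x
    have h1 := integral_div_left_eq_self (fun y => a y * f (y⁻¹ * x)) (haarProb G) x
    simp only [div_eq_mul_inv, mul_inv_rev, inv_inv, inv_mul_cancel_right] at h1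
    exact h1
  rw [h]
  exact L.continuous.comp F.curry.continuous

variable (G) in
/-- `L₁(G)`, for the normalized Haar measure. Convolution on it is `convLp` with `p = 1`. -/
abbrev L1 : Type _ := Lp ℂ 1 (haarProb G)

/-- Convolution `L₁(G) × L_p(G) → L_p(G)`, for `1 ≤ p ≤ ∞`. -/
def convLp {p : ℝ≥0∞} [Fact (1 ≤ p)] (a : L1 G) (f : Lp ℂ p (haarProb G)) :
    Lp ℂ p (haarProb G) :=
  (memLp_convFun (Fact.out : 1 ≤ p) (Lp.memLp a) (Lp.memLp f)).toLp (convFun a f)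

/-- Convolution `L₁(G) × C(G) → C(G)`. -/
def convC (a : L1 G) (f : C(G, ℂ)) : C(G, ℂ) :=
  ⟨convFun a f, continuous_convFun (Lp.memLp a) f.continuous⟩

end Convolution

/-! ### Modules over the convolution algebra `L₁(G)` -/

section Modules

variable (G : Type*) [CommGroup G] [TopologicalSpace G] [IsTopologicalGroup G] [CompactSpace G]
  [T2Space G] [MeasurableSpace G] [BorelSpace G]

/-- A multiplication `L₁(G) × E → E`, without any laws. -/
class L1Action (E : Type*) where
  /-- The product of an element of `L₁(G)` and an element of `E`. -/
  act : L1 G → E → E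

/-- A (left) quasinormed module over the convolution algebra `L₁(G)`: a multiplication that is
bilinear, associative with respect to convolution, and (jointly) continuous. -/
class L1Module (E : Type*) [AddCommGroup E] [Module ℂ E] [TopologicalSpace E]
    [QuasiNormedSpace E] extends L1Action G E where
  add_act : ∀ (a b : L1 G) (x : E), act (a + b) x = act a x + act b x
  smul_act : ∀ (c : ℂ) (a : L1 G) (x : E), act (c • a) x = c • act a x
  act_add : ∀ (a : L1 G) (x y : E), act a (x + y) = act a x + act a y
  act_smul : ∀ (a : L1 G) (c : ℂ) (x : E), act a (c • x) = c • act a x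
  conv_act : ∀ (a b : L1 G) (x : E), act (convLp a b) x = act a (act b x)
  continuous_act : Continuous fun q : L1 G × E => act q.1 q.2

/-- A right quasinormed module over the convolution algebra `L₁(G)`. -/
class RightL1Module (V : Type*) [AddCommGroup V] [Module ℂ V] [TopologicalSpace V]
    [QuasiNormedSpace V] where
  /-- The product of an element of `V` and an element of `L₁(G)`. -/
  ract : V → L1 G → V
  ract_add : ∀ (v : V) (a b : L1 G), ract v (a + b) = ract v a + ract v b
  ract_smul : ∀ (v : V) (c : ℂ) (a : L1 G), ract v (c • a) = c • ract v a
  add_ract : ∀ (v w : V) (a : L1 G), ract (v + w) a = ract v a + ract w a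
  smul_ract : ∀ (c : ℂ) (v : V) (a : L1 G), ract (c • v) a = c • ract v a
  ract_conv : ∀ (v : V) (a b : L1 G), ract v (convLp a b) = ract (ract v a) b
  continuous_ract : Continuous fun q : V × L1 G => ract q.1 q.2

/-- `L_p(G)` with the product of convolution. -/
instance L1Action.instLp (p : ℝ≥0∞) [Fact (1 ≤ p)] : L1Action G (Lp ℂ p (haarProb G)) where
  act a f := convLp a f

/-- `C(G)` with the product of convolution. -/
instance L1Action.instC : L1Action G C(G, ℂ) where
  act a f := convC a f

/-- The dual of a right module, with `⟨a φ, v⟩ = ⟨φ, v a⟩`. -/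
instance L1Action.instDual (V : Type*) [AddCommGroup V] [Module ℂ V] [TopologicalSpace V]
    [QuasiNormedSpace V] [RightL1Module G V] : L1Action G (StrongDual ℂ V) where
  act a φ :=
    { toFun := fun v => φ (RightL1Module.ract v a)
      map_add' := fun v w => by rw [RightL1Module.add_ract, map_add]
      map_smul' := fun c v => by rw [RightL1Module.smul_ract, map_smul, RingHom.id_apply]
      cont := φ.continuous.comp
        ((RightL1Module.continuous_ract (G := G) (V := V)).comp (Continuous.prodMk_left a)) }

/-- The direct sum, with the coordinatewise product. -/
instance L1Action.instProd (Y X : Type*) [L1Action G Y] [L1Action G X] :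
    L1Action G (Y × X) where
  act a w := (L1Action.act a w.1, L1Action.act a w.2)

/-! ### Extensions -/

section Ext

variable {X Y Z : Type*}
  [AddCommGroup X] [Module ℂ X] [TopologicalSpace X] [L1Action G X]
  [AddCommGroup Y] [Module ℂ Y] [TopologicalSpace Y] [L1Action G Y]
  [AddCommGroup Z] [Module ℂ Z] [TopologicalSpace Z] [L1Action G Z]

/-- The operator `T` commutes with the products by elements of `L₁(G)`. -/
def IsL1Hom (T : Y →L[ℂ] Z) : Prop :=
  ∀ (a : L1 G) (y : Y), T (L1Action.act a y) = L1Action.act a (T y)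

/-- `0 → Y → Z → X → 0` is a short exact sequence of homomorphisms. -/
structure IsExtension (i : Y →L[ℂ] Z) (π : Z →L[ℂ] X) : Prop where
  hom_left : IsL1Hom G i
  hom_right : IsL1Hom G π
  injective : Function.Injective i
  exact : ∀ z : Z, π z = 0 ↔ ∃ y : Y, i y = z
  surjective : Function.Surjective π

/-- The extension `0 → Y → Z → X → 0` is equivalent to the direct sum extension
`0 → Y → Y ⊕ X → X → 0`. -/
def IsTrivialExtension (i : Y →L[ℂ] Z) (π : Z →L[ℂ] X) : Prop :=
  ∃ u : Z →L[ℂ] Y × X, IsL1Hom G u ∧ (∀ y : Y, u (i y) = (y, 0)) ∧ ∀ z : Z, (u z).2 = π z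

end Ext

end Modules

/-- `Ext(X, Y) = 0` over `L₁(G)`: every extension `0 → Y → Z → X → 0`, with `Z` a quasi Banach
`L₁(G)`-module, is trivial. The module laws of `Y` and `X` follow from those of `Z`. -/
def ExtEqZero.{w, g, x, y} (G : Type g) [CommGroup G] [TopologicalSpace G]
    [IsTopologicalGroup G] [CompactSpace G] [T2Space G] [MeasurableSpace G] [BorelSpace G]
    (X : Type x) (Y : Type y)
    [AddCommGroup X] [Module ℂ X] [TopologicalSpace X] [L1Action G X]
    [AddCommGroup Y] [Module ℂ Y] [TopologicalSpace Y] [L1Action G Y] : Prop :=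
  ∀ (Z : Type w) [AddCommGroup Z] [Module ℂ Z] [UniformSpace Z] [IsUniformAddGroup Z]
    [CompleteSpace Z] [QuasiNormedSpace Z] [L1Module G Z] (i : Y →L[ℂ] Z) (π : Z →L[ℂ] X),
    IsExtension G i π → IsTrivialExtension G i π

end

universe u v w

/-!
An extension `0 → Y → Z → L₁(G) → 0` is trivial as soon as its quotient map `π` has a right inverse
which is a homomorphism (`IsExtension.isTrivialExtension_of_section`). Such a right inverse is built
from an approximate identity `e_j` of `L₁(G)`, taken along an ultrafilter
(`exists_approximate_identity`), and bounded lifts `z_j` of the `e_j`, given by the open mapping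
theorem. The maps `c ↦ c z_j` are homomorphisms with `π (c z_j) = c * e_j → c`, so it is enough that
they converge pointwise in `Z`, and by boundedness it is enough to have this for `c = a * b` with
`a` continuous. There `c z_j = a (b z_j)`, and since `π (b z_j) = b * e_j` converges to `b`, the
elements `b z_j` are the sum of a convergent family and a bounded family in `Y`. Hence the limit
exists if `a` carries bounded families of `Y` to families converging along the ultrafilter. This is
`IsExtension.isTrivialExtension_of_tendsto`, which moreover allows for first modifying the `z_j` by
an endomorphism `Q` of `Z` with `π Q = π`.

For `Y = L_p(G)`, `1 ≤ p ≤ ∞`, and `Y = C(G)` one takes for `Q` the identity: the convolution with a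
continuous function factors through a compact operator `L₁(G) → C(G)` (`exists_tendsto_convC`).

For `Y` a dual module, multiplication by `a` is not compact. Instead, `e_j z - π(z) z_j` lies in `Y`
because `L₁(G)` is commutative, and the weak* limits of these elements (`exists_weakStar_limit`)
define a homomorphism `P : Z → Y` with `a P(y) = a y` for `y` in `Y`. With `Q = 1 - P` the elements
`a Q(y)` vanish. The dual module may be degenerate, so that `P` need not be a projection onto `Y`;
this is why `P` does not split the extension by itself.

The open mapping theorem is needed for quasi Banach spaces and for strong duals of quasinormed
spaces, and is proved here for complete metrizable topological vector spaces.
-/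

/-! ### The open mapping theorem for complete metrizable vector spaces -/

section OpenMapping

open scoped Pointwise

variable {E F : Type*} [AddCommGroup E] [Module ℂ E] [AddCommGroup F] [Module ℂ F]
  [TopologicalSpace F] [IsTopologicalAddGroup F] [ContinuousSMul ℂ F]

/-- By Baire category, a surjective operator is nearly open. -/
theorem ContinuousLinearMap.closure_image_mem_nhds_zero [TopologicalSpace E]
    [IsTopologicalAddGroup E] [ContinuousSMul ℂ E] [BaireSpace F] (T : E →L[ℂ] F)
    (hT : Function.Surjective T) {U : Set E} (hU : U ∈ 𝓝 (0 : E)) :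
    closure (T '' U) ∈ 𝓝 (0 : F) := by
  obtain ⟨V, hV, hVU⟩ : ∃ V ∈ 𝓝 (0 : E), ∀ v ∈ V, ∀ w ∈ V, v - w ∈ U :=
    exists_nhds_half_neg hU
  have hcover : ⋃ n : ℕ, closure (T '' ((n + 1 : ℂ) • V)) = Set.univ := by
    refine Set.eq_univ_of_forall fun y => Set.mem_iUnion.2 ?_
    obtain ⟨x, rfl⟩ := hT y
    have h1 : Tendsto (fun n : ℕ => ((n + 1 : ℂ))⁻¹ • x) atTop (𝓝 0) := by
      have h2 : Tendsto (fun n : ℕ => ((n + 1 : ℂ))⁻¹) atTop (𝓝 0) := by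
        simpa using tendsto_one_div_add_atTop_nhds_zero_nat (𝕜 := ℂ)
      simpa using h2.smul_const x
    obtain ⟨n, hn⟩ := (h1.eventually hV).exists
    have hn0 : (n + 1 : ℂ) ≠ 0 := Nat.cast_add_one_ne_zero n
    exact ⟨n, subset_closure
      (Set.mem_image_of_mem T ((Set.mem_smul_set_iff_inv_smul_mem₀ hn0 _ _).2 hn))⟩
  obtain ⟨n, y, hy⟩ := nonempty_interior_of_iUnion_of_closed (fun n => isClosed_closure) hcover
  have hn0 : (n + 1 : ℂ) ≠ 0 := Nat.cast_add_one_ne_zero n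
  have h3 : closure (T '' V) ∈ 𝓝 ((n + 1 : ℂ)⁻¹ • y) := by
    have h4 : closure (T '' ((n + 1 : ℂ) • V)) = (n + 1 : ℂ) • closure (T '' V) := by
      rw [← closure_smul₀' hn0, image_smul_set]
    rw [h4] at hy
    have h5 := mem_interior_iff_mem_nhds.1 hy
    have h6 := (continuous_const_smul (n + 1 : ℂ)).continuousAt (x := (n + 1 : ℂ)⁻¹ • y)
    have h7 : (fun x : F => (n + 1 : ℂ) • x) ⁻¹' ((n + 1 : ℂ) • closure (T '' V)) ∈
        𝓝 ((n + 1 : ℂ)⁻¹ • y) := h6 (by simpa [smul_inv_smul₀ hn0] using h5)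
    rwa [Set.preimage_smul₀ hn0, inv_smul_smul₀ hn0] at h7
  set y' := (n + 1 : ℂ)⁻¹ • y
  have h8 : (fun x => x + y') ⁻¹' closure (T '' V) ∈ 𝓝 (0 : F) :=
    (continuous_add_const y').continuousAt (by simpa using h3)
  filter_upwards [h8] with x hx
  have h9 : (x + y') - y' ∈ closure (T '' U) :=
    map_mem_closure₂ continuous_sub hx (mem_of_mem_nhds h3) (by
      rintro _ ⟨v, hv, rfl⟩ _ ⟨w, hw, rfl⟩
      exact ⟨v - w, hVU v hv w hw, map_sub T v w⟩)
  simpa using h9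

/-- A continuous linear surjection from a complete metrizable topological vector space onto a
Hausdorff Baire topological vector space is open. -/
theorem ContinuousLinearMap.isOpenMap_of_surjective_of_baire [UniformSpace E] [IsUniformAddGroup E]
    [ContinuousSMul ℂ E] [CompleteSpace E] [FirstCountableTopology E] [BaireSpace F] [T2Space F]
    (T : E →L[ℂ] F) (hT : Function.Surjective T) : IsOpenMap T := by
  suffices H : ∀ U ∈ 𝓝 (0 : E), T '' U ∈ 𝓝 (0 : F) by
    refine IsOpenMap.of_nhds_le fun x s hs => ?_
    have h1 : (fun z => z + x) ⁻¹' (T ⁻¹' s) ∈ 𝓝 (0 : E) :=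
      (continuous_add_const x).continuousAt (by simpa using hs)
    have h2 : (fun y => y - T x) ⁻¹' (T '' ((fun z => z + x) ⁻¹' (T ⁻¹' s))) ∈ 𝓝 (T x) :=
      (continuous_sub_right (T x)).continuousAt (by simpa using H _ h1)
    filter_upwards [h2] with y hy
    obtain ⟨z, hz, hzy⟩ := hy
    have : y = T (z + x) := by simp [hzy]
    rw [this]
    exact hz
  intro U hU
  obtain ⟨C, ⟨hC, hCcl⟩, hCU⟩ := (closed_nhds_basis (0 : E)).mem_iff.1 hU
  obtain ⟨B, hB⟩ := (𝓝 (0 : E)).exists_antitone_basis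
  -- `V n` is a basis of neighbourhoods of zero with `V (n + 1) + V (n + 1) ⊆ V n`, so that sums of
  -- elements `x n ∈ V (n + 1)` converge, to a point of `C` as `V 0 ⊆ C`.
  have hhalf : ∀ W : Set E, W ∈ 𝓝 (0 : E) → ∃ W' : Set E, W' ∈ 𝓝 (0 : E) ∧
      ∀ v ∈ W', ∀ w ∈ W', v + w ∈ W := fun W hW => by
    obtain ⟨V, hVo, hV, h⟩ := exists_open_nhds_zero_half hW
    exact ⟨V, hVo.mem_nhds hV, h⟩
  choose! D hD hDD using hhalf
  let V : ℕ → Set E := fun n => Nat.rec (C ∩ B 0) (fun n W => D W ∩ B (n + 1)) n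
  have hVs : ∀ n, V (n + 1) = D (V n) ∩ B (n + 1) := fun n => rfl
  have hV : ∀ n, V n ∈ 𝓝 (0 : E) := fun n => by
    induction n with
    | zero => exact inter_mem hC (hB.1.mem_of_mem trivial)
    | succ n ih => exact inter_mem (hD _ ih) (hB.1.mem_of_mem trivial)
  have hVB : ∀ n, V n ⊆ B n := fun n => by cases n <;> exact Set.inter_subset_right
  have hVV : ∀ n, ∀ v ∈ V (n + 1), ∀ w ∈ V (n + 1), v + w ∈ V n := fun n v hv w hw =>
    hDD _ (hV n) v hv.1 w hw.1
  have hV0 : ∀ n, (0 : E) ∈ V n := fun n => mem_of_mem_nhds (hV n)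
  have hnear : ∀ n, closure (T '' V n) ∈ 𝓝 (0 : F) := fun n =>
    T.closure_image_mem_nhds_zero hT (hV n)
  refine mem_of_superset (hnear 1) fun y hy => ?_
  -- `R n` is the part of `y` not yet accounted for after `n` corrections `x 0, …, x (n - 1)`.
  have hstep : ∀ n : ℕ, ∀ r : F, r ∈ closure (T '' V (n + 1)) →
      ∃ x ∈ V (n + 1), r - T x ∈ closure (T '' V (n + 2)) := by
    intro n r hr
    have h1 : (fun w => r - w) ⁻¹' closure (T '' V (n + 2)) ∈ 𝓝 r :=
      (continuous_sub_left r).continuousAt (by simpa using hnear (n + 2))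
    obtain ⟨_, h2, x, hx, rfl⟩ := mem_closure_iff_nhds.1 hr _ h1
    exact ⟨x, hx, h2⟩
  choose! g hgV hgr using hstep
  let R : ℕ → F := fun n => Nat.rec y (fun n r => r - T (g n r)) n
  have hRs : ∀ n, R (n + 1) = R n - T (g n (R n)) := fun n => rfl
  have hR : ∀ n, R n ∈ closure (T '' V (n + 1)) := fun n => by
    induction n with
    | zero => exact hy
    | succ n ih => exact hgr n _ ih
  let x : ℕ → E := fun n => g n (R n)
  have hx : ∀ n, x n ∈ V (n + 1) := fun n => hgV n _ (hR n)
  let S : ℕ → E := fun n => ∑ k ∈ Finset.range n, x k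
  have hTS : ∀ n, T (S n) = y - R n := fun n => by
    induction n with
    | zero => simp [S, R]
    | succ n ih =>
      simp only [S] at ih ⊢
      rw [Finset.sum_range_succ, map_add, ih, hRs]
      simp only [x]
      abel
  have htail : ∀ m n, S (n + m) - S n ∈ V n := by
    intro m
    induction m with
    | zero => intro n; simpa using hV0 n
    | succ m ih =>
      intro n
      have h1 : S (n + (m + 1)) - S n = x n + (S (n + 1 + m) - S (n + 1)) := by
        have : S (n + 1) = S n + x n := Finset.sum_range_succ _ _
        rw [this, show n + (m + 1) = n + 1 + m by ring]
        abel
      rw [h1]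
      exact hVV n _ (hx n) _ (ih (n + 1))
  have hcauchy : CauchySeq S := by
    rw [cauchySeq_iff_tendsto, uniformity_eq_comap_nhds_zero, tendsto_comap_iff]
    intro W hW
    obtain ⟨W₁, hW₁, hsub⟩ : ∃ W₁ ∈ 𝓝 (0 : E), ∀ v ∈ W₁, ∀ w ∈ W₁, v - w ∈ W :=
      exists_nhds_half_neg hW
    obtain ⟨n, -, hn⟩ := hB.1.mem_iff.1 hW₁
    rw [mem_map]
    filter_upwards [eventually_ge_atTop (n, n)] with p hp
    obtain ⟨a, ha⟩ := Nat.exists_eq_add_of_le hp.1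
    obtain ⟨b, hb⟩ := Nat.exists_eq_add_of_le hp.2
    have := hsub _ (hn (hVB n (htail b n))) _ (hn (hVB n (htail a n)))
    simp only [Prod.map, Function.comp, ha, hb, Set.mem_preimage]
    simpa using this
  obtain ⟨x₀, hx₀⟩ := cauchySeq_tendsto_of_complete hcauchy
  refine ⟨x₀, hCU (hCcl.mem_of_tendsto hx₀ (Eventually.of_forall fun n => ?_)), ?_⟩
  · have := htail n 0
    simp only [S, Finset.range_zero, Finset.sum_empty, sub_zero, zero_add] at this
    exact this.1
  · have hR0 : Tendsto R atTop (𝓝 0) := by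
      refine (closed_nhds_basis (0 : F)).tendsto_right_iff.2 fun W ⟨hW, hWc⟩ => ?_
      obtain ⟨n, -, hn⟩ := hB.1.mem_iff.1
        ((T.continuous.tendsto' 0 0 (map_zero T)) hW)
      filter_upwards [eventually_ge_atTop n] with m hm
      refine closure_minimal (Set.image_subset_iff.2 ?_) hWc (hR m)
      exact (hVB _).trans ((hB.2 (hm.trans m.le_succ)).trans hn)
    have h1 : Tendsto (fun n => T (S n)) atTop (𝓝 (y - 0)) := by
      simp only [hTS]
      exact tendsto_const_nhds.sub hR0
    rw [sub_zero] at h1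
    exact tendsto_nhds_unique (T.continuous.continuousAt.tendsto.comp hx₀) h1

/-- An injective operator with closed range between complete metrizable topological vector spaces
is an embedding. -/
theorem ContinuousLinearMap.isEmbedding_of_isClosed_range [UniformSpace E] [IsUniformAddGroup E]
    [ContinuousSMul ℂ E] [CompleteSpace E] [FirstCountableTopology E]
    {Z : Type*} [AddCommGroup Z] [Module ℂ Z] [UniformSpace Z] [IsUniformAddGroup Z]
    [ContinuousSMul ℂ Z] [CompleteSpace Z] [FirstCountableTopology Z] [T2Space Z]
    (T : E →L[ℂ] Z) (hT : Function.Injective T) (hc : IsClosed (Set.range T)) :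
    IsEmbedding T := by
  let R : Submodule ℂ Z := LinearMap.range (T : E →ₗ[ℂ] Z)
  have hR : IsClosed (R : Set Z) := hc
  have : CompleteSpace R := hR.completeSpace_coe
  have : IsUniformAddGroup R := inferInstanceAs (IsUniformAddGroup R.toAddSubgroup)
  have : FirstCountableTopology R := Topology.IsInducing.subtypeVal.firstCountableTopology
  have : (uniformity R).IsCountablyGenerated := IsUniformAddGroup.uniformity_countably_generated
  let T' : E →L[ℂ] R := T.codRestrict R fun x => ⟨x, rfl⟩
  have hs : Function.Surjective T' := by
    rintro ⟨_, x, rfl⟩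
    exact ⟨x, rfl⟩
  have ho : IsOpenMap T' := T'.isOpenMap_of_surjective_of_baire hs
  have hi : Function.Injective T' := fun x y h => hT (congrArg Subtype.val h)
  exact IsEmbedding.subtypeVal.comp
    (IsOpenEmbedding.of_continuous_injective_isOpenMap T'.continuous hi ho).isEmbedding

end OpenMapping

/-! ### Topological properties of quasinormed spaces -/

namespace QuasiNormedSpace

theorem hasBasis_nhds_zero (E : Type*) [AddCommGroup E] [TopologicalSpace E] {q : E → ℝ}
    (hb : ∀ x : E, (𝓝 x).HasBasis (fun ε : ℝ => 0 < ε) (fun ε => {y | q (y - x) < ε})) :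
    (𝓝 (0 : E)).HasBasis (fun ε : ℝ => 0 < ε) (fun ε => {y | q y < ε}) := by
  simpa using hb 0

theorem isVonNBounded_of_quasiNorm_le {E : Type*} [AddCommGroup E] [Module ℂ E]
    [TopologicalSpace E] {q : E → ℝ} (hq : IsQuasiNorm q)
    (hb : ∀ x : E, (𝓝 x).HasBasis (fun ε : ℝ => 0 < ε) (fun ε => {y | q (y - x) < ε}))
    {S : Set E} {M : ℝ} (hS : ∀ x ∈ S, q x ≤ M) : Bornology.IsVonNBounded ℂ S := by
  refine (hasBasis_nhds_zero E hb).isVonNBounded_iff.2 fun ε hε => ?_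
  refine absorbs_iff_norm.2 ⟨(|M| + 1) / ε, fun c hc x hx => ?_⟩
  have hc0 : 0 < ‖c‖ := lt_of_lt_of_le (by positivity) hc
  rw [Set.mem_smul_set_iff_inv_smul_mem₀ (norm_pos_iff.1 hc0)]
  change q (c⁻¹ • x) < ε
  rw [hq.map_smul, norm_inv, inv_mul_lt_iff₀ hc0]
  have h1 : |M| + 1 ≤ ‖c‖ * ε := (div_le_iff₀ hε).1 hc
  linarith [hS x hx, le_abs_self M]

variable (E : Type*) [AddCommGroup E] [Module ℂ E] [TopologicalSpace E] [QuasiNormedSpace E]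

theorem exists_quasiNorm_one_le : ∃ (q : E → ℝ) (K : ℝ), IsQuasiNorm q ∧ 1 ≤ K ∧
    (∀ x y, q (x + y) ≤ K * (q x + q y)) ∧
    ∀ x : E, (𝓝 x).HasBasis (fun ε : ℝ => 0 < ε) (fun ε => {y | q (y - x) < ε}) := by
  obtain ⟨q, hq, hb⟩ := exists_quasiNorm (E := E)
  obtain ⟨K, hK⟩ := hq.add_le
  refine ⟨q, max K 1, hq, le_max_right _ _, fun x y => (hK x y).trans ?_, hb⟩
  exact mul_le_mul_of_nonneg_right (le_max_left _ _) (add_nonneg (hq.nonneg x) (hq.nonneg y))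

theorem isTopologicalAddGroup : IsTopologicalAddGroup E := by
  obtain ⟨q, K, hq, hK1, hK, hb⟩ := exists_quasiNorm_one_le E
  have hK0 : 0 < K := by linarith
  refine { continuous_add := ?_, continuous_neg := ?_ }
  · refine continuous_iff_continuousAt.2 fun ⟨x, y⟩ => ?_
    rw [ContinuousAt, nhds_prod_eq]
    refine (hb _).tendsto_right_iff.2 fun ε hε => ?_
    have hδ : 0 < ε / (2 * K) := by positivity
    filter_upwards [prod_mem_prod ((hb x).mem_of_mem hδ) ((hb y).mem_of_mem hδ)] with p hp
    have h1 : q (p.1 - x) < ε / (2 * K) := hp.1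
    have h2 : q (p.2 - y) < ε / (2 * K) := hp.2
    calc q (p.1 + p.2 - (x + y)) = q ((p.1 - x) + (p.2 - y)) := by congr 1; abel
      _ ≤ K * (q (p.1 - x) + q (p.2 - y)) := hK _ _
      _ < K * (ε / (2 * K) + ε / (2 * K)) := by gcongr
      _ = ε := by field_simp; ring
  · refine continuous_iff_continuousAt.2 fun x => (hb _).tendsto_right_iff.2 fun ε hε => ?_
    filter_upwards [(hb x).mem_of_mem hε] with y hy
    have h1 : -y - -x = (-1 : ℂ) • (y - x) := by rw [neg_one_smul]; abel
    have h3 : q (y - x) < ε := hy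
    change q (-y - -x) < ε
    rw [h1, hq.map_smul]
    simpa using h3

theorem continuousSMul : ContinuousSMul ℂ E := by
  have := isTopologicalAddGroup E
  obtain ⟨q, K, hq, hK1, hK, hb⟩ := exists_quasiNorm_one_le E
  have hb0 := hasBasis_nhds_zero E hb
  have hq0 := hq.nonneg
  refine ContinuousSMul.of_nhds_zero ?_ (fun m => ?_) fun c => ?_
  · refine hb0.tendsto_right_iff.2 fun ε hε => ?_
    filter_upwards [prod_mem_prod (Metric.ball_mem_nhds (0 : ℂ) one_pos) (hb0.mem_of_mem hε)]
      with p hp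
    have h1 : ‖p.1‖ < 1 := by simpa using hp.1
    have h2 : q p.2 < ε := hp.2
    change q (p.1 • p.2) < ε
    rw [hq.map_smul]
    nlinarith [hq0 p.2, norm_nonneg p.1]
  · refine hb0.tendsto_right_iff.2 fun ε hε => ?_
    have h : Tendsto (fun c : ℂ => ‖c‖ * q m) (𝓝 0) (𝓝 0) :=
      (continuous_norm.mul continuous_const).tendsto' _ _ (by simp)
    filter_upwards [h.eventually (gt_mem_nhds hε)] with c hc
    change q (c • m) < ε
    rwa [hq.map_smul]
  · refine hb0.tendsto_right_iff.2 fun ε hε => ?_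
    have hc : 0 < ‖c‖ + 1 := by positivity
    filter_upwards [hb0.mem_of_mem (show 0 < ε / (‖c‖ + 1) by positivity)] with x hx
    change q (c • x) < ε
    rw [hq.map_smul]
    have h1 : q x * (‖c‖ + 1) < ε := (lt_div_iff₀ hc).1 hx
    nlinarith [hq0 x]

theorem t2Space : T2Space E := by
  have := isTopologicalAddGroup E
  obtain ⟨q, K, hq, hK1, hK, hb⟩ := exists_quasiNorm_one_le E
  refine IsTopologicalAddGroup.t2Space_of_zero_sep fun x hx => ?_
  have h1 : 0 < q x := lt_of_le_of_ne (hq.nonneg x) fun h => hx ((hq.eq_zero_iff x).1 h.symm)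
  exact ⟨_, (hasBasis_nhds_zero E hb).mem_of_mem h1, fun h => lt_irrefl (q x) h⟩

theorem firstCountableTopology : FirstCountableTopology E := by
  obtain ⟨q, K, hq, hK1, hK, hb⟩ := exists_quasiNorm_one_le E
  refine ⟨fun x => ?_⟩
  have h : 𝓝 x = comap (fun y => q (y - x)) (𝓝 0) := by
    refine (hb x).eq_of_same_basis ?_
    convert Metric.nhds_basis_ball.comap (fun y => q (y - x)) using 2 with ε
    ext y
    simp [abs_of_nonneg (hq.nonneg _)]
  rw [h]
  infer_instance

/-- A quasinormed space is locally bounded. -/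
theorem exists_isVonNBounded_mem_nhds_zero :
    ∃ B ∈ 𝓝 (0 : E), Bornology.IsVonNBounded ℂ B := by
  obtain ⟨q, K, hq, hK1, hK, hb⟩ := exists_quasiNorm_one_le E
  exact ⟨{x | q x < 1}, (hasBasis_nhds_zero E hb).mem_of_mem one_pos,
    isVonNBounded_of_quasiNorm_le hq hb (M := 1) fun x hx => le_of_lt hx⟩

variable {E} in
/-- An open operator from a quasinormed space onto a normed space has a right inverse, in general
not linear, of size `O(‖x‖)`. -/
theorem exists_bounded_lift {X : Type*} [NormedAddCommGroup X] [NormedSpace ℂ X] (π : E →L[ℂ] X)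
    (hπ : IsOpenMap π) : ∃ ρ : X → E, (∀ x, π (ρ x) = x) ∧ Tendsto ρ (𝓝 0) (𝓝 0) ∧
      ∀ M : ℝ, Bornology.IsVonNBounded ℂ (ρ '' {x | ‖x‖ ≤ M}) := by
  obtain ⟨q, K, hq, hK1, hK, hb⟩ := exists_quasiNorm_one_le E
  have hb0 := hasBasis_nhds_zero E hb
  have h1 : π '' {z | q z < 1} ∈ 𝓝 (0 : X) := by
    simpa using hπ.image_mem_nhds (hb0.mem_of_mem one_pos)
  obtain ⟨δ, hδ, hball⟩ := Metric.mem_nhds_iff.1 h1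
  have h2 : ∀ x : X, ∃ z : E, π z = x ∧ q z ≤ 2 / δ * ‖x‖ := by
    intro x
    rcases eq_or_ne x 0 with rfl | hx
    · exact ⟨0, map_zero π, by simp [(hq.eq_zero_iff 0).2 rfl]⟩
    have hx0 : 0 < ‖x‖ := norm_pos_iff.2 hx
    set t : ℝ := δ / (2 * ‖x‖) with ht
    have ht0 : 0 < t := by positivity
    have htc : (t : ℂ) ≠ 0 := by exact_mod_cast ht0.ne'
    have hmem : (t : ℂ) • x ∈ Metric.ball (0 : X) δ := by
      rw [mem_ball_zero_iff, norm_smul, Complex.norm_real, Real.norm_of_nonneg ht0.le, ht]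
      have : δ / (2 * ‖x‖) * ‖x‖ = δ / 2 := by field_simp
      rw [this]
      linarith
    obtain ⟨z, hz, hzx⟩ := hball hmem
    refine ⟨(t : ℂ)⁻¹ • z, by rw [map_smul, hzx, inv_smul_smul₀ htc], ?_⟩
    rw [hq.map_smul, norm_inv, Complex.norm_real, Real.norm_of_nonneg ht0.le]
    have h3 : t⁻¹ = 2 / δ * ‖x‖ := by rw [ht]; field_simp
    rw [← h3]
    have h4 : q z ≤ 1 := le_of_lt hz
    exact mul_le_of_le_one_right (by positivity) h4
  choose ρ hρ hρq using h2
  refine ⟨ρ, hρ, hb0.tendsto_right_iff.2 fun ε hε => ?_, fun M => ?_⟩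
  · have h : Tendsto (fun x : X => 2 / δ * ‖x‖) (𝓝 0) (𝓝 0) :=
      (continuous_const.mul continuous_norm).tendsto' _ _ (by simp)
    filter_upwards [h.eventually (gt_mem_nhds hε)] with x hx
    exact (hρq x).trans_lt hx
  · refine isVonNBounded_of_quasiNorm_le hq hb (M := 2 / δ * M) ?_
    rintro _ ⟨x, hx, rfl⟩
    exact (hρq x).trans (by have : ‖x‖ ≤ M := hx; gcongr)

variable (V : Type*) [AddCommGroup V] [Module ℂ V] [TopologicalSpace V] [QuasiNormedSpace V]

/-- The strong topology of the dual is that of uniform convergence on one bounded neighbourhood of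
zero. -/
theorem firstCountableTopology_strongDual : FirstCountableTopology (StrongDual ℂ V) := by
  obtain ⟨B, hB, hBb⟩ := exists_isVonNBounded_mem_nhds_zero V
  have hbasis : (𝓝 (0 : StrongDual ℂ V)).HasBasis (fun n : ℕ => True)
      (fun n => {φ | Set.MapsTo φ B (Metric.ball 0 (1 / ((n : ℝ) + 1)))}) := by
    have h0 := ContinuousLinearMap.hasBasis_nhds_zero_of_basis (σ := RingHom.id ℂ) (E := V)
      (Metric.nhds_basis_ball (x := (0 : ℂ)))
    refine h0.to_hasBasis ?_ fun n _ => ⟨(B, 1 / ((n : ℝ) + 1)), ⟨hBb, by positivity⟩,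
      fun φ hφ => hφ⟩
    rintro ⟨S, ε⟩ ⟨hS, hε⟩
    obtain ⟨c, hc, hcS⟩ : ∃ c : ℂ, c ≠ 0 ∧ ∀ x ∈ S, ∃ b ∈ B, c • b = x := by
      obtain ⟨r, hr⟩ := absorbs_iff_norm.1 (hS hB)
      refine ⟨((|r| + 1 : ℝ) : ℂ), ?_, fun x hx => Set.mem_smul_set.1 (hr _ ?_ hx)⟩
      · exact_mod_cast (by positivity : |r| + 1 ≠ 0)
      · rw [Complex.norm_real, Real.norm_of_nonneg (by positivity)]
        linarith [le_abs_self r]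
    have hc0 : 0 < ‖c‖ := norm_pos_iff.2 hc
    obtain ⟨n, hn⟩ := exists_nat_one_div_lt (show 0 < ε / ‖c‖ by positivity)
    refine ⟨n, trivial, fun φ hφ x hx => ?_⟩
    obtain ⟨b, hb, rfl⟩ := hcS x hx
    have h1 := hφ hb
    rw [mem_ball_zero_iff] at h1 ⊢
    simp only [map_smul, smul_eq_mul, norm_mul]
    rw [lt_div_iff₀ hc0] at hn
    nlinarith
  have : (𝓝 (0 : StrongDual ℂ V)).IsCountablyGenerated := hbasis.isCountablyGenerated
  refine ⟨fun φ => ?_⟩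
  rw [← map_add_left_nhds_zero φ]
  infer_instance

theorem completeSpace_strongDual : CompleteSpace (StrongDual ℂ V) := by
  have := isTopologicalAddGroup V
  have := continuousSMul V
  have := firstCountableTopology V
  infer_instance

end QuasiNormedSpace

/-! ### The convolution algebra `L₁(G)` and its approximate identity -/

section ApproximateIdentity

variable {G : Type*} [CommGroup G] [TopologicalSpace G] [IsTopologicalGroup G] [CompactSpace G]
  [T2Space G] [MeasurableSpace G] [BorelSpace G]

theorem convFun_comm (a f : G → ℂ) : convFun a f = convFun f a := by
  funext x
  have h := integral_div_left_eq_self (fun y => a (x * y⁻¹) * f y) (haarProb G) x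
  simp only [div_eq_mul_inv, mul_inv_rev, inv_inv] at h
  rw [convFun, ← h]
  refine integral_congr_ae (Eventually.of_forall fun y => ?_)
  have : x * (y * x⁻¹) = y := by rw [mul_comm y, mul_inv_cancel_left]
  simp only [this, mul_comm]

theorem convLp_comm (a b : L1 G) : convLp a b = convLp b a := by
  unfold convLp
  simp only [convFun_comm (a : G → ℂ) b]

/-- Up to modification on null sets, the integrand of the convolution of two integrable functions
is integrable for the product measure. -/
theorem exists_integrable_conv_prod {a f : G → ℂ} (ha : Integrable a (haarProb G))
    (hf : Integrable f (haarProb G)) : ∃ b g : G → ℂ, a =ᵐ[haarProb G] b ∧ f =ᵐ[haarProb G] g ∧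
      Integrable (fun p : G × G => b (p.1 * p.2⁻¹) * g p.2) ((haarProb G).prod (haarProb G)) ∧
      ∫ p : G × G, ‖b (p.1 * p.2⁻¹) * g p.2‖ ∂((haarProb G).prod (haarProb G)) =
        (∫ x, ‖a x‖ ∂(haarProb G)) * ∫ x, ‖f x‖ ∂(haarProb G) := by
  obtain ⟨b, hab, hb⟩ := exists_good_representative ha
  obtain ⟨g, hg, hfg⟩ := hf.1
  have hbi := ha.congr hab
  have hgi := hf.congr hfg
  have hm : AEStronglyMeasurable (fun p : G × G => b (p.1 * p.2⁻¹) * g p.2)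
      ((haarProb G).prod (haarProb G)) :=
    (hb.mul (hg.measurable.comp measurable_snd)).aestronglyMeasurable
  have hin : ∀ y, ∫ x, ‖b (x * y⁻¹) * g y‖ ∂(haarProb G) =
      (∫ x, ‖b x‖ ∂(haarProb G)) * ‖g y‖ := fun y => by
    have h := integral_mul_right_eq_self (μ := haarProb G) (fun x => ‖b x‖) y⁻¹
    have h' := integral_mul_const (μ := haarProb G) ‖g y‖ fun x => ‖b (x * y⁻¹)‖
    rw [h] at h'
    simpa only [norm_mul] using h'
  have hint : Integrable (fun p : G × G => b (p.1 * p.2⁻¹) * g p.2)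
      ((haarProb G).prod (haarProb G)) := by
    refine (integrable_prod_iff' hm).2 ⟨Eventually.of_forall fun y => ?_, ?_⟩
    · have h : Integrable (fun x => b (x * y⁻¹)) (haarProb G) := hbi.comp_mul_right y⁻¹
      exact h.mul_const (g y)
    · simp only [hin]
      exact hgi.norm.const_mul _
  refine ⟨b, g, hab, hfg, hint, ?_⟩
  rw [integral_prod_symm _ hint.norm]
  simp only [hin]
  rw [integral_const_mul, integral_congr_ae (f := fun x => ‖a x‖) (hab.fun_comp norm),
    integral_congr_ae (f := fun x => ‖f x‖) (hfg.fun_comp norm)]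
  rfl

/-- For almost every `x`, the convolution of `a` and `f` at `x` is a genuine integral. -/
theorem ae_integrable_conv (a f : L1 G) :
    ∀ᵐ x ∂(haarProb G), Integrable (fun y => a (x * y⁻¹) * f y) (haarProb G) := by
  obtain ⟨b, g, hab, hfg, hint, -⟩ :=
    exists_integrable_conv_prod (L1.integrable_coeFn a) (L1.integrable_coeFn f)
  filter_upwards [hint.prod_right_ae] with x hx
  refine hx.congr ?_
  filter_upwards [(measurePreserving_mul_inv x).quasiMeasurePreserving.ae hab, hfg] with y h1 h2
  rw [h1, h2]

theorem coeFn_convLp {p : ℝ≥0∞} [Fact (1 ≤ p)] (a : L1 G) (f : Lp ℂ p (haarProb G)) :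
    convLp a f =ᵐ[haarProb G] convFun a f :=
  MemLp.coeFn_toLp _

theorem convLp_add (a f g : L1 G) : convLp a (f + g) = convLp a f + convLp a g := by
  refine Lp.ext ?_
  filter_upwards [coeFn_convLp a (f + g), coeFn_convLp a f, coeFn_convLp a g,
    Lp.coeFn_add (convLp a f) (convLp a g), ae_integrable_conv a f, ae_integrable_conv a g]
    with x h1 h2 h3 h4 h5 h6
  rw [h4, Pi.add_apply, h1, h2, h3, convFun_congr (ae_eq_refl a) (Lp.coeFn_add f g)]
  unfold convFun
  rw [← integral_add h5 h6]
  simp only [Pi.add_apply, mul_add]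

theorem convLp_sub (a f g : L1 G) : convLp a (f - g) = convLp a f - convLp a g := by
  rw [eq_sub_iff_add_eq, ← convLp_add, sub_add_cancel]

theorem norm_convLp_le (a f : L1 G) : ‖convLp a f‖ ≤ ‖a‖ * ‖f‖ := by
  obtain ⟨b, g, hab, hfg, hint, hnorm⟩ :=
    exists_integrable_conv_prod (L1.integrable_coeFn a) (L1.integrable_coeFn f)
  rw [L1.norm_eq_integral_norm, L1.norm_eq_integral_norm, L1.norm_eq_integral_norm, ← hnorm,
    integral_congr_ae (f := fun x => ‖convLp a f x‖) ((coeFn_convLp a f).fun_comp norm)]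
  simp only [Function.comp_apply]
  rw [convFun_congr hab hfg, integral_prod _ hint.norm]
  exact integral_mono_of_nonneg (Eventually.of_forall fun x => norm_nonneg _)
    hint.norm.integral_prod_left (Eventually.of_forall fun x => norm_integral_le_integral_norm _)

theorem continuous_convLp (a : L1 G) : Continuous fun f : L1 G => convLp a f := by
  refine (LipschitzWith.of_dist_le_mul (K := ‖a‖₊) fun f g => ?_).continuous
  rw [dist_eq_norm, dist_eq_norm, ← convLp_sub]
  exact norm_convLp_le a (f - g)

/-- Averages of a continuous function over small neighbourhoods of the identity are uniformly
close to the function. -/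
theorem exists_nhds_norm_convFun_indicator_sub_le (g : C(G, ℂ)) {η : ℝ} (hη : 0 < η) :
    ∃ U₀ ∈ 𝓝 (1 : G), ∀ U : Set G, IsOpen U → (1 : G) ∈ U → U ⊆ U₀ → ∀ x,
      ‖convFun (U.indicator fun _ => (((haarProb G).real U)⁻¹ : ℂ)) g x - g x‖ ≤ η := by
  let F : C(G × G, ℂ) := ⟨fun q => g (q.2 * q.1⁻¹), by fun_prop⟩
  have h1 := (Metric.continuous_iff'.1 F.curry.continuous) 1 η hη
  refine ⟨_, h1, fun U hU h1U hUU x => ?_⟩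
  have hμ : (haarProb G).real U ≠ 0 :=
    (ENNReal.toReal_pos (hU.measure_pos _ ⟨1, h1U⟩).ne' (measure_ne_top _ _)).ne'
  set c : ℂ := (((haarProb G).real U)⁻¹ : ℂ) with hc
  have hgi : ∀ k : G → ℂ, Continuous k → IntegrableOn k U (haarProb G) := fun k hk =>
    (hk.integrable_of_hasCompactSupport (HasCompactSupport.of_compactSpace k)).integrableOn
  have h2 : convFun (U.indicator fun _ => c) g x - g x =
      ∫ y in U, c * (g (x * y⁻¹) - g x) ∂(haarProb G) := by
    have h3 : ∀ y, g (x * y⁻¹) * U.indicator (fun _ => c) y =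
        U.indicator (fun y => c * g (x * y⁻¹)) y := fun y => by
      by_cases hy : y ∈ U <;> simp [hy, mul_comm]
    rw [convFun_comm, convFun]
    simp only [h3, mul_sub]
    rw [integral_indicator hU.measurableSet, integral_sub (hgi _ (by fun_prop))
      (hgi _ (by fun_prop)), setIntegral_const, hc, Complex.real_smul, ← mul_assoc,
      mul_inv_cancel₀ (by exact_mod_cast hμ), one_mul]
  rw [h2]
  refine (norm_setIntegral_le_of_norm_le_const (C := ‖c‖ * η) (measure_lt_top _ _)
    fun y hy => ?_).trans_eq ?_
  · rw [norm_mul]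
    gcongr
    have h4 : dist (F.curry y) (F.curry 1) < η := hUU hy
    have h5 := (ContinuousMap.dist_apply_le_dist (f := F.curry y) (g := F.curry 1) x).trans h4.le
    simpa [F, dist_eq_norm] using h5
  · rw [hc, norm_inv, Complex.norm_real, Real.norm_of_nonneg measureReal_nonneg]
    field_simp

/-- `L₁(G)` has an approximate identity in its unit ball, here indexed by an ultrafilter. -/
theorem exists_approximate_identity (G : Type*) [CommGroup G] [TopologicalSpace G]
    [IsTopologicalGroup G] [CompactSpace G] [T2Space G] [MeasurableSpace G] [BorelSpace G] :
    ∃ (𝒰 : Ultrafilter (OpenNhdsOf (1 : G))) (e : OpenNhdsOf (1 : G) → L1 G),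
      (∀ j, ‖e j‖ ≤ 1) ∧ ∀ f : L1 G, Tendsto (fun j => convLp (e j) f) 𝒰 (𝓝 f) := by
  let e : OpenNhdsOf (1 : G) → L1 G := fun U =>
    indicatorConstLp 1 U.isOpen.measurableSet (measure_ne_top (haarProb G) _)
      (((haarProb G).real U)⁻¹ : ℂ)
  have he : ∀ j, ‖e j‖ ≤ 1 := fun U => by
    simp only [e]
    rw [norm_indicatorConstLp one_ne_zero ENNReal.one_ne_top, norm_inv, Complex.norm_real,
      Real.norm_of_nonneg measureReal_nonneg]
    simpa using inv_mul_le_one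
  have hlim : ∀ f : L1 G, Tendsto (fun j => convLp (e j) f) atBot (𝓝 f) := by
    intro f
    refine Metric.tendsto_nhds.2 fun η hη => ?_
    obtain ⟨g, hg⟩ := (ContinuousMap.toLp_denseRange ℂ (haarProb G) ℂ
      ENNReal.one_ne_top).exists_dist_lt f (show 0 < η / 4 by positivity)
    obtain ⟨U₀, hU₀, hU⟩ := exists_nhds_norm_convFun_indicator_sub_le g
      (show 0 < η / 4 by positivity)
    obtain ⟨U₁, hU₁, hU₁o, h1⟩ := mem_nhds_iff.1 hU₀
    filter_upwards [eventually_le_atBot (⟨⟨U₁, hU₁o⟩, h1⟩ : OpenNhdsOf (1 : G))] with U hle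
    set g' : L1 G := ContinuousMap.toLp 1 (haarProb G) ℂ g with hg'
    have h2 : ‖convLp (e U) g' - g'‖ ≤ η / 4 := by
      refine (Lp.norm_le_of_ae_bound (C := η / 4) (by positivity) ?_).trans_eq
        (by simp [measureUnivNNReal])
      filter_upwards [Lp.coeFn_sub (convLp (e U) g') g', coeFn_convLp (e U) g',
        ContinuousMap.coeFn_toLp (p := 1) (haarProb G) (𝕜 := ℂ) g] with x h3 h4 h5
      rw [h3, Pi.sub_apply, h4, h5, convFun_congr indicatorConstLp_coeFn
        (ContinuousMap.coeFn_toLp (p := 1) (haarProb G) (𝕜 := ℂ) g)]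
      exact hU _ U.isOpen U.mem (Set.Subset.trans hle hU₁) x
    have h3 : convLp (e U) f - f = convLp (e U) (f - g') + (convLp (e U) g' - g') - (f - g') := by
      rw [convLp_sub]
      abel
    rw [dist_eq_norm] at hg ⊢
    have h4 : ‖convLp (e U) (f - g')‖ ≤ ‖f - g'‖ :=
      (norm_convLp_le _ _).trans (mul_le_of_le_one_left (norm_nonneg _) (he U))
    rw [h3]
    refine (norm_sub_le _ _).trans_lt ?_
    have h5 := norm_add_le (convLp (e U) (f - g')) (convLp (e U) g' - g')
    linarith
  exact ⟨Ultrafilter.of atBot, e, he, fun f => (hlim f).mono_left (Ultrafilter.of_le _)⟩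

end ApproximateIdentity

/-! ### Quasi Banach modules and their extensions -/

section Extensions

variable {G : Type*} [CommGroup G] [TopologicalSpace G] [IsTopologicalGroup G] [CompactSpace G]
  [T2Space G] [MeasurableSpace G] [BorelSpace G]

namespace L1Module

variable {Z : Type*} [AddCommGroup Z] [Module ℂ Z] [TopologicalSpace Z] [QuasiNormedSpace Z]
  [L1Module G Z]

/-- Multiplication by a fixed element of `L₁(G)`, as an operator. -/
def actCLM (Z : Type*) [AddCommGroup Z] [Module ℂ Z] [TopologicalSpace Z] [QuasiNormedSpace Z]
    [L1Module G Z] (a : L1 G) : Z →L[ℂ] Z where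
  toFun z := L1Action.act a z
  map_add' := act_add a
  map_smul' c z := act_smul a c z
  cont := continuous_act.comp (Continuous.prodMk_right a)

/-- Multiplication of a fixed element of the module, as an operator on `L₁(G)`. -/
def orbitCLM (z : Z) : L1 G →L[ℂ] Z where
  toFun a := L1Action.act a z
  map_add' a b := add_act a b z
  map_smul' c a := smul_act c a z
  cont := continuous_act.comp (Continuous.prodMk_left z)

theorem act_sub (a : L1 G) (x y : Z) :
    L1Action.act a (x - y) = L1Action.act a x - L1Action.act a y :=
  map_sub (actCLM Z a) x y

theorem sub_act (a b : L1 G) (x : Z) :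
    L1Action.act (a - b) x = L1Action.act a x - L1Action.act b x :=
  map_sub (orbitCLM x) a b

/-- Small elements of `L₁(G)` are uniformly small as multipliers on bounded sets. -/
theorem exists_forall_act_mem {S : Set Z} (hS : Bornology.IsVonNBounded ℂ S) {W : Set Z}
    (hW : W ∈ 𝓝 (0 : Z)) : ∃ δ > 0, ∀ a : L1 G, ‖a‖ < δ → ∀ z ∈ S, L1Action.act a z ∈ W := by
  have h0 : L1Action.act (0 : L1 G) (0 : Z) = 0 := map_zero (actCLM Z (0 : L1 G))
  have h1 : (fun p : L1 G × Z => L1Action.act p.1 p.2) ⁻¹' W ∈ 𝓝 ((0 : L1 G), (0 : Z)) :=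
    continuous_act.continuousAt (by simpa [h0] using hW)
  obtain ⟨A, hA, U, hU, hAU⟩ := mem_nhds_prod_iff.1 h1
  obtain ⟨δ, hδ, hball⟩ := Metric.mem_nhds_iff.1 hA
  obtain ⟨r, hr⟩ := absorbs_iff_norm.1 (hS hU)
  set t : ℂ := ((|r| + 1 : ℝ) : ℂ) with ht
  have htn : ‖t‖ = |r| + 1 := by
    rw [ht, Complex.norm_real, Real.norm_of_nonneg (by positivity)]
  have ht0 : 0 < ‖t‖ := by rw [htn]; positivity
  refine ⟨δ / ‖t‖, by positivity, fun a ha z hz => ?_⟩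
  obtain ⟨u, hu, rfl⟩ := hr t (by rw [htn]; linarith [le_abs_self r]) hz
  have h2 : t • a ∈ A := hball (by
    rw [mem_ball_zero_iff, norm_smul, mul_comm]
    exact (lt_div_iff₀ ht0).1 ha)
  have h3 : L1Action.act (t • a) u ∈ W := hAU (Set.mk_mem_prod h2 hu)
  rw [smul_act] at h3
  change L1Action.act a (t • u) ∈ W
  rwa [act_smul]

/-- Small elements of the module remain uniformly small after multiplication by the elements of
a ball of `L₁(G)`. -/
theorem exists_nhds_forall_act_mem (M : ℝ) {W : Set Z} (hW : W ∈ 𝓝 (0 : Z)) :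
    ∃ U ∈ 𝓝 (0 : Z), ∀ a : L1 G, ‖a‖ ≤ M → ∀ z ∈ U, L1Action.act a z ∈ W := by
  have h0 : L1Action.act (0 : L1 G) (0 : Z) = 0 := map_zero (actCLM Z (0 : L1 G))
  have h1 : (fun p : L1 G × Z => L1Action.act p.1 p.2) ⁻¹' W ∈ 𝓝 ((0 : L1 G), (0 : Z)) :=
    continuous_act.continuousAt (by simpa [h0] using hW)
  obtain ⟨A, hA, U, hU, hAU⟩ := mem_nhds_prod_iff.1 h1
  obtain ⟨δ, hδ, hball⟩ := Metric.mem_nhds_iff.1 hA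
  have := QuasiNormedSpace.continuousSMul Z
  set t : ℂ := (((|M| + 1) / δ : ℝ) : ℂ) with ht
  have htn : ‖t‖ = (|M| + 1) / δ := by
    rw [ht, Complex.norm_real, Real.norm_of_nonneg (by positivity)]
  have ht0 : 0 < ‖t‖ := by rw [htn]; positivity
  have htz : t ≠ 0 := norm_pos_iff.1 ht0
  refine ⟨(fun z => t • z) ⁻¹' U, (continuous_const_smul t).continuousAt (by simpa using hU),
    fun a ha z hz => ?_⟩
  have h2 : t⁻¹ • a ∈ A := hball (by
    rw [mem_ball_zero_iff, norm_smul, norm_inv, inv_mul_lt_iff₀ ht0, htn, div_mul_cancel₀ _ hδ.ne']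
    linarith [le_abs_self M])
  have h3 : L1Action.act (t⁻¹ • a) (t • z) ∈ W := hAU (Set.mk_mem_prod h2 hz)
  rwa [smul_act, act_smul, inv_smul_smul₀ htz] at h3

end L1Module

variable {X Y Z : Type*}
  [AddCommGroup X] [Module ℂ X] [TopologicalSpace X] [L1Action G X]
  [AddCommGroup Y] [Module ℂ Y] [TopologicalSpace Y] [L1Action G Y]
  [AddCommGroup Z] [Module ℂ Z] [UniformSpace Z] [IsUniformAddGroup Z] [QuasiNormedSpace Z]
  [L1Module G Z]

/-- An extension is trivial as soon as its quotient map has a right inverse homomorphism. -/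
theorem IsExtension.isTrivialExtension_of_section {i : Y →L[ℂ] Z} {π : Z →L[ℂ] X}
    (h : IsExtension G i π)
    (hi : IsEmbedding i) (s : X →L[ℂ] Z) (hs : IsL1Hom G s) (hπs : ∀ x, π (s x) = x) :
    IsTrivialExtension G i π := by
  have h1 : ∀ z, ∃ y, i y = z - s (π z) := fun z => (h.exact _).1 (by rw [map_sub, hπs, sub_self])
  choose r hr using h1
  let R : Z →L[ℂ] Y :=
    { toFun := r
      map_add' := fun z w => h.injective (by
        rw [map_add, hr, hr, hr, map_add, map_add]
        abel)
      map_smul' := fun c z => h.injective (by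
        rw [RingHom.id_apply, map_smul, hr, hr, map_smul, map_smul, smul_sub])
      cont := hi.continuous_iff.2 (by
        have : i ∘ r = fun z => z - s (π z) := funext hr
        change Continuous (i ∘ r)
        rw [this]
        exact continuous_id.sub (s.continuous.comp π.continuous)) }
  refine ⟨R.prod π, fun a z => Prod.ext (h.injective ?_) (h.hom_right a z), fun y => ?_,
    fun z => rfl⟩
  · change i (r (L1Action.act a z)) = i (L1Action.act a (r z))
    rw [hr, h.hom_left, hr, h.hom_right, hs, L1Module.act_sub]
  · have hπ : π (i y) = 0 := (h.exact _).2 ⟨y, rfl⟩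
    refine Prod.ext (h.injective ?_) hπ
    change i (r (i y)) = i y
    rw [hr, hπ, map_zero, sub_zero]

variable [CompleteSpace Z]

/-- The operators `c ↦ c z_j` attached to a bounded family `z_j` converge pointwise along `𝒰` as
soon as they converge on a dense set. -/
theorem L1Module.exists_tendsto_of_dense {ι : Type*} {𝒰 : Filter ι} [𝒰.NeBot] {ζ : ι → Z}
    (hζ : Bornology.IsVonNBounded ℂ (Set.range ζ)) {D : Set (L1 G)} (hD : Dense D)
    (hDζ : ∀ c ∈ D, ∃ w, Tendsto (fun j => L1Action.act c (ζ j)) 𝒰 (𝓝 w)) (c : L1 G) :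
    ∃ w, Tendsto (fun j => L1Action.act c (ζ j)) 𝒰 (𝓝 w) := by
  refine CompleteSpace.complete (f := map (fun j => L1Action.act c (ζ j)) 𝒰)
    (cauchy_map_iff.2 ⟨inferInstance, ?_⟩)
  rw [uniformity_eq_comap_nhds_zero, tendsto_comap_iff]
  intro W hW
  obtain ⟨V, hVo, hV0, hV⟩ := exists_open_nhds_zero_half hW
  obtain ⟨V', hV'o, hV'0, hV'⟩ := exists_open_nhds_zero_half (hVo.mem_nhds hV0)
  obtain ⟨δ, hδ, hact⟩ := L1Module.exists_forall_act_mem (G := G) hζ (hV'o.mem_nhds hV'0)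
  obtain ⟨d, hdD, hcd⟩ := hD.exists_dist_lt c hδ
  obtain ⟨w, hw⟩ := hDζ d hdD
  have h1 : Tendsto (fun p : ι × ι => L1Action.act d (ζ p.2) - L1Action.act d (ζ p.1)) (𝒰 ×ˢ 𝒰)
      (𝓝 0) := by
    simpa using (hw.comp tendsto_snd).sub (hw.comp tendsto_fst)
  have h2 : ∀ j, L1Action.act (c - d) (ζ j) ∈ V' := fun j =>
    hact _ (by rwa [← dist_eq_norm]) _ ⟨j, rfl⟩
  have h3 : ∀ j, L1Action.act (d - c) (ζ j) ∈ V' := fun j =>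
    hact _ (by rwa [← dist_eq_norm, dist_comm]) _ ⟨j, rfl⟩
  rw [mem_map]
  filter_upwards [h1 (hVo.mem_nhds hV0)] with p hp
  have h4 := hV _ (hV' _ (h2 p.2) _ (h3 p.1)) _ hp
  simp only [L1Module.sub_act] at h4
  simp only [Set.mem_preimage, Function.comp]
  convert h4 using 1
  abel

namespace IsExtension

/-- The inclusion of an extension is an embedding, by the open mapping theorem. -/
theorem isEmbedding {Y : Type*} [AddCommGroup Y] [Module ℂ Y] [UniformSpace Y]
    [IsUniformAddGroup Y] [CompleteSpace Y] [FirstCountableTopology Y] [ContinuousSMul ℂ Y]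
    [L1Action G Y] [T1Space X] {i : Y →L[ℂ] Z} {π : Z →L[ℂ] X} (h : IsExtension G i π) :
    IsEmbedding i := by
  have := QuasiNormedSpace.continuousSMul Z
  have := QuasiNormedSpace.t2Space Z
  have := QuasiNormedSpace.firstCountableTopology Z
  refine i.isEmbedding_of_isClosed_range h.injective ?_
  have : Set.range i = π ⁻¹' {0} := by
    ext z
    exact (h.exact z).symm
  rw [this]
  exact isClosed_singleton.preimage π.continuous

/-- Let `Q` be an endomorphism of an extension of `L₁(G)` by `Y` that induces the identity of
`L₁(G)`, and suppose that `a Q` carries bounded families of `Y` to convergent ones, for all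
continuous functions `a`. If `z_j` are bounded lifts of an approximate identity, the operators
`c ↦ c Q(z_j)` converge to a right inverse of the quotient map: for `c = a * b`, the elements
`b z_j` differ from the terms of a convergent family by elements of `Y`. -/
theorem isTrivialExtension_of_tendsto {i : Y →L[ℂ] Z} {π : Z →L[ℂ] L1 G}
    (h : IsExtension G i π) (hi : IsEmbedding i) {ι : Type*} {𝒰 : Ultrafilter ι} {e : ι → L1 G}
    (he : ∀ j, ‖e j‖ ≤ 1) (hlim : ∀ f : L1 G, Tendsto (fun j => convLp (e j) f) 𝒰 (𝓝 f))
    {ρ : L1 G → Z} (hρ : ∀ f, π (ρ f) = f) (hρ0 : Tendsto ρ (𝓝 0) (𝓝 0))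
    (hρb : ∀ M : ℝ, Bornology.IsVonNBounded ℂ (ρ '' {f | ‖f‖ ≤ M}))
    (Q : Z →L[ℂ] Z) (hQ : IsL1Hom G Q) (hπQ : ∀ z, π (Q z) = π z)
    (H : ∀ (a : C(G, ℂ)) (y : ι → Y), Bornology.IsVonNBounded ℂ (Set.range fun j => i (y j)) →
      ∃ w, Tendsto (fun j => L1Action.act
        (ContinuousMap.toLp 1 (haarProb G) ℂ a : L1 G) (Q (i (y j)))) 𝒰 (𝓝 w)) :
    IsTrivialExtension G i π := by
  have := QuasiNormedSpace.continuousSMul Z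
  have := QuasiNormedSpace.t2Space Z
  let z : ι → Z := fun j => ρ (e j)
  have hz : Bornology.IsVonNBounded ℂ (Set.range z) :=
    (hρb 1).subset (by rintro _ ⟨j, rfl⟩; exact ⟨e j, he j, rfl⟩)
  have hζ : Bornology.IsVonNBounded ℂ (Set.range fun j => Q (z j)) :=
    (hz.image Q).subset (by rintro _ ⟨j, rfl⟩; exact ⟨z j, ⟨j, rfl⟩, rfl⟩)
  have hlim' : ∀ f : L1 G, Tendsto (fun j => convLp f (e j)) 𝒰 (𝓝 f) := fun f => by
    simpa only [convLp_comm] using hlim f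
  -- Products `a * b` with `a` continuous are dense, as `e j * c → c` and `C(G)` is dense in `L₁(G)`.
  let D : Set (L1 G) :=
    {c | ∃ (a : C(G, ℂ)) (b : L1 G), convLp (ContinuousMap.toLp 1 (haarProb G) ℂ a : L1 G) b = c}
  have hD : Dense D := by
    intro c
    have h1 : ∀ a : L1 G, convLp a c ∈ closure D := fun a => by
      have h2 : a ∈ closure (Set.range (ContinuousMap.toLp 1 (haarProb G) ℂ : C(G, ℂ) → L1 G)) :=
        ContinuousMap.toLp_denseRange ℂ (haarProb G) ℂ ENNReal.one_ne_top a
      rw [convLp_comm]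
      refine map_mem_closure (continuous_convLp c) h2 ?_
      rintro _ ⟨a, rfl⟩
      exact ⟨a, c, convLp_comm _ _⟩
    exact isClosed_closure.mem_of_tendsto (hlim c) (Eventually.of_forall fun j => h1 _)
  have hDζ : ∀ c ∈ D, ∃ w, Tendsto (fun j => L1Action.act c (Q (z j))) 𝒰 (𝓝 w) := by
    rintro _ ⟨a, b, rfl⟩
    set a' : L1 G := ContinuousMap.toLp 1 (haarProb G) ℂ a
    -- `ρ b + r j` is a convergent family with the same images under `π` as `b z_j`; the difference
    -- `i (y j)` is covered by the hypothesis `H`.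
    let r : ι → Z := fun j => ρ (convLp b (e j) - b)
    have hr0 : Tendsto r 𝒰 (𝓝 0) := hρ0.comp (by simpa using (hlim' b).sub_const b)
    have hrb : Bornology.IsVonNBounded ℂ (Set.range r) := by
      refine (hρb (‖b‖ + ‖b‖)).subset ?_
      rintro _ ⟨j, rfl⟩
      refine ⟨_, (norm_sub_le _ _).trans (add_le_add_left ?_ _), rfl⟩
      exact (norm_convLp_le b (e j)).trans (mul_le_of_le_one_right (norm_nonneg b) (he j))
    have h1 : ∀ j, ∃ y, i y = L1Action.act b (z j) - (ρ b + r j) := fun j => by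
      refine (h.exact _).1 ?_
      rw [map_sub, map_add, h.hom_right, hρ, hρ, hρ]
      change convLp b (e j) - _ = 0
      abel
    choose y hy using h1
    have hyb : Bornology.IsVonNBounded ℂ (Set.range fun j => i (y j)) := by
      refine ((hz.image (L1Module.actCLM Z b)).sub
        ((Bornology.isVonNBounded_singleton (𝕜 := ℂ) (ρ b)).add hrb)).subset ?_
      rintro _ ⟨j, rfl⟩
      exact ⟨_, ⟨z j, ⟨j, rfl⟩, rfl⟩, _, ⟨ρ b, rfl, r j, ⟨j, rfl⟩, rfl⟩, (hy j).symm⟩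
    obtain ⟨w, hw⟩ := H a y hyb
    refine ⟨L1Action.act a' (Q (ρ b)) + L1Action.act a' (Q 0) + w, ?_⟩
    have h2 : ∀ j, L1Action.act (convLp a' b) (Q (z j)) = L1Action.act a' (Q (ρ b)) +
        L1Action.act a' (Q (r j)) + L1Action.act a' (Q (i (y j))) := fun j => by
      rw [L1Module.conv_act, ← hQ, ← L1Module.act_add, ← L1Module.act_add, ← map_add, ← map_add,
        hy, add_sub_cancel]
    simp only [h2]
    exact (tendsto_const_nhds.add
      (((L1Module.actCLM Z a').continuous.comp Q.continuous).continuousAt.tendsto.comp hr0)).add hw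
  choose s hs using L1Module.exists_tendsto_of_dense hζ hD hDζ
  let S₀ : L1 G →ₗ[ℂ] Z :=
    { toFun := s
      map_add' := fun c d => tendsto_nhds_unique (hs (c + d)) (by
        simpa only [L1Module.add_act] using (hs c).add (hs d))
      map_smul' := fun t c => tendsto_nhds_unique (hs (t • c)) (by
        simpa only [L1Module.smul_act, RingHom.id_apply] using (hs c).const_smul t) }
  have hS₀ : Continuous S₀ := by
    refine continuous_of_continuousAt_zero S₀ ?_
    rw [ContinuousAt, map_zero]
    refine (closed_nhds_basis (0 : Z)).tendsto_right_iff.2 fun W ⟨hW, hWc⟩ => ?_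
    obtain ⟨δ, hδ, hact⟩ := L1Module.exists_forall_act_mem (G := G) hζ hW
    filter_upwards [Metric.ball_mem_nhds (0 : L1 G) hδ] with c hc
    exact hWc.mem_of_tendsto (hs c) (Eventually.of_forall fun j =>
      hact c (mem_ball_zero_iff.1 hc) _ ⟨j, rfl⟩)
  refine h.isTrivialExtension_of_section hi ⟨S₀, hS₀⟩ (fun d c => ?_) fun c => ?_
  · refine tendsto_nhds_unique (hs (convLp d c)) ?_
    simp only [L1Module.conv_act]
    exact (L1Module.actCLM Z d).continuous.continuousAt.tendsto.comp (hs c)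
  · refine tendsto_nhds_unique (π.continuous.continuousAt.tendsto.comp (hs c)) ?_
    have h1 : (π ∘ fun j => L1Action.act c (Q (z j))) = fun j => convLp c (e j) := by
      funext j
      change π (L1Action.act c (Q (ρ (e j)))) = _
      rw [h.hom_right, hπQ, hρ]
      rfl
    rw [h1]
    exact hlim' c

/-- The quotient map of an extension of `L₁(G)` has a bounded (nonlinear) right inverse. -/
theorem exists_bounded_lift {i : Y →L[ℂ] Z} {π : Z →L[ℂ] L1 G} (h : IsExtension G i π) :
    ∃ ρ : L1 G → Z, (∀ f, π (ρ f) = f) ∧ Tendsto ρ (𝓝 0) (𝓝 0) ∧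
      ∀ M : ℝ, Bornology.IsVonNBounded ℂ (ρ '' {f | ‖f‖ ≤ M}) := by
  have := QuasiNormedSpace.continuousSMul Z
  have := QuasiNormedSpace.firstCountableTopology Z
  exact QuasiNormedSpace.exists_bounded_lift π
    (π.isOpenMap_of_surjective_of_baire h.surjective)

end IsExtension
end Extensions

/-! ### Modules on which continuous functions act compactly -/

section CompactAction

theorem norm_integral_mul_coeFn_le {α : Type*} [TopologicalSpace α] [CompactSpace α]
    [MeasurableSpace α] [BorelSpace α] {μ : Measure α} (k : C(α, ℂ)) (f : Lp ℂ 1 μ) :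
    ‖∫ y, k y * f y ∂μ‖ ≤ ‖k‖ * ‖f‖ := by
  rw [L1.norm_eq_integral_norm, ← integral_const_mul]
  refine norm_integral_le_of_norm_le ((L1.integrable_coeFn f).norm.const_mul _)
    (Eventually.of_forall fun y => ?_)
  rw [norm_mul]
  gcongr
  exact k.norm_coe_le_norm y

theorem integrable_mul_coeFn {α : Type*} [TopologicalSpace α] [CompactSpace α] [MeasurableSpace α]
    [BorelSpace α] {μ : Measure α} (k : C(α, ℂ)) (f : Lp ℂ 1 μ) :
    Integrable (fun y => k y * f y) μ :=
  (L1.integrable_coeFn f).bdd_mul (c := ‖k‖) k.continuous.aestronglyMeasurable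
    (Eventually.of_forall k.norm_coe_le_norm)

variable {G : Type*} [CommGroup G] [TopologicalSpace G] [IsTopologicalGroup G] [CompactSpace G]
  [T2Space G] [MeasurableSpace G] [BorelSpace G]

/-- Convolution with a continuous function is a compact operator from `L₁(G)` to `C(G)`, by the
theorem of Arzelà and Ascoli. -/
theorem exists_tendsto_convC (a : C(G, ℂ)) {ι : Type*} (𝒰 : Ultrafilter ι) {f : ι → L1 G} {M : ℝ}
    (hf : ∀ j, ‖f j‖ ≤ M) : ∃ k : C(G, ℂ), Tendsto (fun j => convC (f j) a) 𝒰 (𝓝 k) := by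
  let F : C(G × G, ℂ) := ⟨fun q => a (q.1 * q.2⁻¹), by fun_prop⟩
  have hF : ∀ (f : L1 G) (x : G), convC f a x = ∫ y, F.curry x y * f y ∂(haarProb G) :=
    fun f x => congrFun (convFun_comm f a) x
  let Φ := ContinuousMap.isometryEquivBoundedOfCompact G ℂ
  let A : Set (BoundedContinuousFunction G ℂ) := Set.range fun j => Φ (convC (f j) a)
  have hA : IsCompact (closure A) := by
    refine BoundedContinuousFunction.arzela_ascoli (Metric.closedBall 0 (‖F‖ * M))
      (isCompact_closedBall _ _) A ?_ ?_
    · rintro _ x ⟨j, rfl⟩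
      rw [mem_closedBall_zero_iff]
      change ‖convC (f j) a x‖ ≤ _
      rw [hF]
      refine (norm_integral_mul_coeFn_le _ _).trans ?_
      gcongr
      · exact (ContinuousMap.norm_le _ (norm_nonneg _)).2 fun y => F.norm_coe_le_norm (x, y)
      · exact hf j
    · intro x₀
      refine Metric.equicontinuousAt_iff_right.2 fun ε hε => ?_
      have h1 := (Metric.continuous_iff'.1 F.curry.continuous) x₀ (ε / (|M| + 1)) (by positivity)
      filter_upwards [h1] with x hx
      rintro ⟨_, j, rfl⟩
      change dist (convC (f j) a x₀) (convC (f j) a x) < ε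
      rw [dist_comm, dist_eq_norm, hF, hF, ← integral_sub (integrable_mul_coeFn _ _)
        (integrable_mul_coeFn _ _)]
      have h2 : ∀ y, F.curry x y * f j y - F.curry x₀ y * f j y =
          (F.curry x - F.curry x₀) y * f j y := fun y => by
        rw [ContinuousMap.sub_apply, sub_mul]
      simp only [h2]
      refine (norm_integral_mul_coeFn_le _ _).trans_lt ?_
      rw [dist_eq_norm, lt_div_iff₀ (by positivity)] at hx
      have h3 : ‖f j‖ ≤ |M| + 1 := (hf j).trans (by linarith [le_abs_self M])
      exact (mul_le_mul_of_nonneg_left h3 (norm_nonneg _)).trans_lt hx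
  obtain ⟨k, -, hk⟩ := hA.ultrafilter_le_nhds (𝒰.map fun j => Φ (convC (f j) a))
    (le_principal_iff.2 (mem_map.2 (Eventually.of_forall fun j => subset_closure ⟨j, rfl⟩)))
  refine ⟨Φ.symm k, ?_⟩
  have h4 : Tendsto (fun j => Φ (convC (f j) a)) 𝒰 (𝓝 k) := hk
  simpa [Function.comp_def] using (Φ.symm.continuous.tendsto k).comp h4

theorem Bornology.IsVonNBounded.of_image_of_isInducing {Y Z : Type*} [AddCommGroup Y] [Module ℂ Y]
    [TopologicalSpace Y] [AddCommGroup Z] [Module ℂ Z] [TopologicalSpace Z] {i : Y →L[ℂ] Z}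
    (hi : IsInducing i) {S : Set Y} (hS : Bornology.IsVonNBounded ℂ (i '' S)) :
    Bornology.IsVonNBounded ℂ S := by
  intro V hV
  rw [hi.nhds_eq_comap, map_zero] at hV
  obtain ⟨W, hW, hWV⟩ := hV
  obtain ⟨r, hr⟩ := absorbs_iff_norm.1 (hS hW)
  refine absorbs_iff_norm.2 ⟨max r 1, fun c hc y hy => ?_⟩
  have hc0 : c ≠ 0 := norm_pos_iff.1 (one_pos.trans_le ((le_max_right _ _).trans hc))
  have h1 := hr c ((le_max_left _ _).trans hc) (Set.mem_image_of_mem i hy)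
  rw [Set.mem_smul_set_iff_inv_smul_mem₀ hc0] at h1 ⊢
  exact hWV (by simpa using h1)

/-- Extensions of `L₁(G)` by `Y` are trivial if the multiplication of `Y` by continuous functions
factors through `convC : L₁(G) × C(G) → C(G)`. -/
theorem IsExtension.isTrivialExtension_of_factorization {Y Z : Type*} [NormedAddCommGroup Y]
    [NormedSpace ℂ Y] [CompleteSpace Y] [L1Action G Y]
    [AddCommGroup Z] [Module ℂ Z] [UniformSpace Z] [IsUniformAddGroup Z] [CompleteSpace Z]
    [QuasiNormedSpace Z] [L1Module G Z] {i : Y →L[ℂ] Z} {π : Z →L[ℂ] L1 G}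
    (h : IsExtension G i π) (I : Y → L1 G) (hI : ∀ y, ‖I y‖ ≤ ‖y‖) (J : C(G, ℂ) →L[ℂ] Y)
    (hIJ : ∀ (a : C(G, ℂ)) (y : Y), L1Action.act
      (ContinuousMap.toLp 1 (haarProb G) ℂ a : L1 G) y = J (convC (I y) a)) :
    IsTrivialExtension G i π := by
  obtain ⟨𝒰, e, he, hlim⟩ := exists_approximate_identity G
  obtain ⟨ρ, hρ, hρ0, hρb⟩ := h.exists_bounded_lift
  refine h.isTrivialExtension_of_tendsto h.isEmbedding he hlim hρ hρ0 hρb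
    (ContinuousLinearMap.id ℂ Z) (fun _ _ => rfl) (fun _ => rfl) fun a y hy => ?_
  have hyb : Bornology.IsVonNBounded ℂ (Set.range y) :=
    .of_image_of_isInducing h.isEmbedding.isInducing (by rwa [← Set.range_comp])
  obtain ⟨M, hM⟩ := (NormedSpace.isVonNBounded_iff ℂ).1 hyb |>.exists_norm_le
  obtain ⟨k, hk⟩ := exists_tendsto_convC a 𝒰 fun j => (hI (y j)).trans (hM _ ⟨j, rfl⟩)
  refine ⟨i (J k), ?_⟩
  have h1 : ∀ j, L1Action.act (ContinuousMap.toLp 1 (haarProb G) ℂ a : L1 G) (i (y j)) =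
      i (J (convC (I (y j)) a)) := fun j => by rw [← h.hom_left, hIJ]
  simp only [ContinuousLinearMap.id_apply, h1]
  exact ((i.continuous.comp J.continuous).tendsto k).comp hk

/-- The convolution of a continuous function with `f ∈ L_p(G) ⊆ L₁(G)` is a continuous function. -/
theorem extEqZero_Lp (p : ℝ≥0∞) [Fact (1 ≤ p)] : ExtEqZero G (L1 G) (Lp ℂ p (haarProb G)) := by
  intro Z _ _ _ _ _ _ _ i π h
  have hp : (1 : ℝ≥0∞) ≤ p := Fact.out
  refine h.isTrivialExtension_of_factorization
    (fun f => ((Lp.memLp f).mono_exponent hp).toLp f) (fun f => ?_)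
    (ContinuousMap.toLp p (haarProb G) ℂ) fun a f => ?_
  · rw [Lp.norm_toLp, Lp.norm_def]
    exact ENNReal.toReal_mono (Lp.eLpNorm_ne_top f)
      (eLpNorm_le_eLpNorm_of_exponent_le hp (Lp.aestronglyMeasurable f))
  · refine Lp.ext ?_
    set a' : L1 G := ContinuousMap.toLp 1 (haarProb G) ℂ a
    have h1 : convFun a' f =
        convFun (((Lp.memLp f).mono_exponent hp).toLp f : L1 G) a := by
      rw [convFun_comm]
      exact convFun_congr (MemLp.coeFn_toLp _).symm (ContinuousMap.coeFn_toLp (haarProb G) a)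
    filter_upwards [coeFn_convLp a' f, ContinuousMap.coeFn_toLp (p := p) (haarProb G) (𝕜 := ℂ)
      (convC (((Lp.memLp f).mono_exponent hp).toLp f) a)] with x h2 h3
    rw [h3]
    exact h2.trans (congrFun h1 x)

theorem extEqZero_C : ExtEqZero G (L1 G) C(G, ℂ) := by
  intro Z _ _ _ _ _ _ _ i π h
  refine h.isTrivialExtension_of_factorization (fun f => ContinuousMap.toLp 1 (haarProb G) ℂ f)
    (fun f => ?_) (ContinuousLinearMap.id ℂ _) fun a f => ?_
  · refine (Lp.norm_le_of_ae_bound (C := ‖f‖) (norm_nonneg _) ?_).trans_eq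
      (by simp [measureUnivNNReal])
    filter_upwards [ContinuousMap.coeFn_toLp (p := 1) (haarProb G) (𝕜 := ℂ) f] with x hx
    rw [hx]
    exact f.norm_coe_le_norm x
  · ext x
    have h1 := ContinuousMap.coeFn_toLp (p := 1) (haarProb G) (𝕜 := ℂ) a
    have h2 := ContinuousMap.coeFn_toLp (p := 1) (haarProb G) (𝕜 := ℂ) f
    have h3 : convFun (ContinuousMap.toLp 1 (haarProb G) ℂ a : L1 G) f =
        convFun (ContinuousMap.toLp 1 (haarProb G) ℂ f : L1 G) a := by
      rw [convFun_comm]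
      exact convFun_congr h2.symm h1
    exact congrFun h3 x

end CompactAction

/-! ### Dual modules -/

section DualModules

variable {G : Type*} [CommGroup G] [TopologicalSpace G] [IsTopologicalGroup G] [CompactSpace G]
  [T2Space G] [MeasurableSpace G] [BorelSpace G]

variable {V Z : Type*} [AddCommGroup V] [Module ℂ V] [TopologicalSpace V] [QuasiNormedSpace V]

/-- A family of linear maps into a dual space, equicontinuous at zero, has a continuous linear
weak* limit along every ultrafilter. -/
theorem exists_weakStar_limit [AddCommGroup Z] [Module ℂ Z] [TopologicalSpace Z]
    [IsTopologicalAddGroup Z] [ContinuousSMul ℂ Z] {ι : Type*} (𝒰 : Ultrafilter ι)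
    (P : ι → Z →ₗ[ℂ] StrongDual ℂ V)
    (hP : ∀ N ∈ 𝓝 (0 : StrongDual ℂ V), ∃ U ∈ 𝓝 (0 : Z), ∀ z ∈ U, ∀ j, P j z ∈ N) :
    ∃ P₀ : Z →L[ℂ] StrongDual ℂ V, ∀ z v, Tendsto (fun j => P j z v) 𝒰 (𝓝 (P₀ z v)) := by
  have := QuasiNormedSpace.isTopologicalAddGroup V
  have := QuasiNormedSpace.continuousSMul V
  have hbound : ∀ S : Set V, Bornology.IsVonNBounded ℂ S → ∀ z : Z, ∃ r : ℝ,
      ∀ j, ∀ v ∈ S, ‖P j z v‖ ≤ r := by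
    intro S hS z
    obtain ⟨U, hU, h⟩ := hP _ (ContinuousLinearMap.eventually_nhds_zero_mapsTo hS
      (Metric.closedBall_mem_nhds (0 : ℂ) one_pos))
    obtain ⟨r, hr⟩ := absorbs_iff_norm.1 (absorbent_nhds_zero (𝕜 := ℂ) hU z)
    obtain ⟨u, hu, hz⟩ := hr ((|r| : ℝ) : ℂ) (by simp [le_abs_self]) (Set.mem_singleton z)
    refine ⟨|r|, fun j v hv => ?_⟩
    have h1 := mem_closedBall_zero_iff.1 (h u hu j hv)
    have h2 : z = ((|r| : ℝ) : ℂ) • u := hz.symm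
    rw [h2, map_smul, smul_apply, norm_smul]
    simpa using mul_le_mul_of_nonneg_left h1 (abs_nonneg r)
  have hlim : ∀ z v, ∃ c : ℂ, Tendsto (fun j => P j z v) 𝒰 (𝓝 c) := by
    intro z v
    obtain ⟨r, hr⟩ := hbound {v} (Bornology.isVonNBounded_singleton (𝕜 := ℂ) v) z
    obtain ⟨c, -, hc⟩ := (isCompact_closedBall (0 : ℂ) r).ultrafilter_le_nhds
      (𝒰.map fun j => P j z v) (le_principal_iff.2 (mem_map.2 (Eventually.of_forall fun j =>
        mem_closedBall_zero_iff.2 (hr j v rfl))))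
    exact ⟨c, hc⟩
  choose p hp using hlim
  let φ : Z → V →ₗ[ℂ] ℂ := fun z =>
    { toFun := p z
      map_add' := fun v w => tendsto_nhds_unique (hp z (v + w)) (by
        simpa only [map_add] using (hp z v).add (hp z w))
      map_smul' := fun c v => tendsto_nhds_unique (hp z (c • v)) (by
        simpa only [map_smul, RingHom.id_apply] using (hp z v).const_smul c) }
  obtain ⟨B, hB, hBb⟩ := QuasiNormedSpace.exists_isVonNBounded_mem_nhds_zero V
  let Φ : Z → StrongDual ℂ V := fun z => (φ z).clmOfExistsBoundedImage ⟨B, hB, by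
    obtain ⟨r, hr⟩ := hbound B hBb z
    refine (NormedSpace.isVonNBounded_closedBall ℂ ℂ r).subset ?_
    rintro _ ⟨v, hv, rfl⟩
    exact Metric.isClosed_closedBall.mem_of_tendsto (hp z v) (Eventually.of_forall fun j =>
      mem_closedBall_zero_iff.2 (hr j v hv))⟩
  have hΦ : ∀ z v, Tendsto (fun j => P j z v) 𝒰 (𝓝 (Φ z v)) := hp
  let Ψ : Z →ₗ[ℂ] StrongDual ℂ V :=
    { toFun := Φ
      map_add' := fun z w => ContinuousLinearMap.ext fun v =>
        tendsto_nhds_unique (hΦ (z + w) v) (by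
          simpa only [map_add, add_apply] using (hΦ z v).add (hΦ w v))
      map_smul' := fun c z => ContinuousLinearMap.ext fun v =>
        tendsto_nhds_unique (hΦ (c • z) v) (by
          simpa only [map_smul, smul_apply, RingHom.id_apply]
            using (hΦ z v).const_smul c) }
  refine ⟨⟨Ψ, continuous_of_continuousAt_zero Ψ ?_⟩, hΦ⟩
  rw [ContinuousAt, map_zero]
  have hbasis := ContinuousLinearMap.hasBasis_nhds_zero_of_basis (σ := RingHom.id ℂ) (E := V)
    (Metric.nhds_basis_closedBall (x := (0 : ℂ)))
  refine hbasis.tendsto_right_iff.2 ?_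
  rintro ⟨S, ε⟩ ⟨hS, hε⟩
  obtain ⟨U, hU, h⟩ := hP _ (hbasis.mem_of_mem (i := (S, ε)) ⟨hS, hε⟩)
  filter_upwards [hU] with z hz
  intro v hv
  exact Metric.isClosed_closedBall.mem_of_tendsto (hΦ z v) (Eventually.of_forall fun j =>
    h z hz j v hv)

/-- For bounded lifts `z_j` of an approximate identity `e_j`, the elements `e_j z - π(z) z_j`
belong to the dual module by commutativity. A weak* limit of them is a homomorphism `P` with
`a P(φ) = a φ` for `φ` in the dual module, so that `z ↦ z - P(z)` is an endomorphism of the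
extension whose restriction to the dual module is annihilated by `L₁(G)`. -/
theorem extEqZero_strongDual [RightL1Module G V] : ExtEqZero G (L1 G) (StrongDual ℂ V) := by
  intro Z _ _ _ _ _ _ _ i π h
  have := QuasiNormedSpace.continuousSMul Z
  have := QuasiNormedSpace.firstCountableTopology_strongDual V
  have := QuasiNormedSpace.completeSpace_strongDual V
  have hi : IsEmbedding i := h.isEmbedding
  obtain ⟨𝒰, e, he, hlim⟩ := exists_approximate_identity G
  obtain ⟨ρ, hρ, hρ0, hρb⟩ := h.exists_bounded_lift
  -- Commutativity puts `e j z - π(z) z_j` in the kernel of `π`, and makes it linear over `L₁(G)`.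
  have h1 : ∀ j z, ∃ φ, i φ = L1Action.act (e j) z - L1Action.act (π z) (ρ (e j)) :=
    fun j z => (h.exact _).1 (by
      rw [map_sub, h.hom_right, h.hom_right, hρ, sub_eq_zero]
      exact convLp_comm _ _)
  choose p hp using h1
  let P : OpenNhdsOf (1 : G) → Z →ₗ[ℂ] StrongDual ℂ V := fun j =>
    { toFun := p j
      map_add' := fun z w => h.injective (by
        rw [map_add, hp, hp, hp, map_add, L1Module.act_add, L1Module.add_act]
        abel)
      map_smul' := fun c z => h.injective (by
        rw [RingHom.id_apply, map_smul, hp, hp, map_smul, L1Module.act_smul, L1Module.smul_act,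
          smul_sub]) }
  have hPhom : ∀ j (a : L1 G) z, P j (L1Action.act a z) = L1Action.act a (P j z) := fun j a z =>
    h.injective (by
      change i (p j _) = i (L1Action.act a (p j z))
      have h2 : L1Action.act (π (L1Action.act a z)) (ρ (e j)) =
          L1Action.act a (L1Action.act (π z) (ρ (e j))) := by
        rw [h.hom_right, ← L1Module.conv_act]
        rfl
      rw [hp, h.hom_left, hp, h2, L1Module.act_sub, ← L1Module.conv_act, convLp_comm,
        L1Module.conv_act])
  -- The dual carries the topology induced by `Z`, so the `P j` are equicontinuous because `e j` and
  -- `ρ (e j)` are bounded.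
  have hPeq : ∀ N ∈ 𝓝 (0 : StrongDual ℂ V), ∃ U ∈ 𝓝 (0 : Z), ∀ z ∈ U, ∀ j, P j z ∈ N := by
    intro N hN
    rw [hi.isInducing.nhds_eq_comap, map_zero] at hN
    obtain ⟨W, hW, hWN⟩ := hN
    obtain ⟨W₁, hW₁, hsub⟩ : ∃ W₁ ∈ 𝓝 (0 : Z), ∀ v ∈ W₁, ∀ w ∈ W₁, v - w ∈ W :=
      exists_nhds_half_neg hW
    obtain ⟨U, hU, h2⟩ := L1Module.exists_nhds_forall_act_mem (G := G) 1 hW₁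
    obtain ⟨δ, hδ, h3⟩ := L1Module.exists_forall_act_mem (G := G) (hρb 1) hW₁
    have h4 : π ⁻¹' Metric.ball 0 δ ∈ 𝓝 (0 : Z) :=
      π.continuous.continuousAt (by simpa using Metric.ball_mem_nhds (0 : L1 G) hδ)
    refine ⟨U ∩ π ⁻¹' Metric.ball 0 δ, inter_mem hU h4, fun z hz j => hWN ?_⟩
    change i (p j z) ∈ W
    rw [hp]
    exact hsub _ (h2 _ (he j) z hz.1) _ (h3 _ (mem_ball_zero_iff.1 hz.2) _ ⟨e j, he j, rfl⟩)
  obtain ⟨P₀, hP₀⟩ := exists_weakStar_limit 𝒰 P hPeq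
  have hP₀hom : ∀ (a : L1 G) z, P₀ (L1Action.act a z) = L1Action.act a (P₀ z) := fun a z =>
    ContinuousLinearMap.ext fun v => tendsto_nhds_unique (hP₀ (L1Action.act a z) v) (by
      simp only [hPhom]
      exact hP₀ z (RightL1Module.ract v a))
  have hP₀i : ∀ (a : L1 G) (φ : StrongDual ℂ V),
      L1Action.act a (P₀ (i φ)) = L1Action.act a φ := fun a φ =>
    ContinuousLinearMap.ext fun v =>
      tendsto_nhds_unique (hP₀ (i φ) (RightL1Module.ract v a)) (by
        have h2 : ∀ j, P j (i φ) = L1Action.act (e j) φ := fun j => h.injective (by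
          change i (p j (i φ)) = _
          have h3 : π (i φ) = 0 := (h.exact _).2 ⟨φ, rfl⟩
          have h4 : L1Action.act (0 : L1 G) (ρ (e j)) = 0 :=
            map_zero (L1Module.orbitCLM (ρ (e j)))
          rw [hp, h.hom_left, h3, h4, sub_zero])
        have h5 : ∀ j, P j (i φ) (RightL1Module.ract v a) =
            φ (RightL1Module.ract v (convLp (e j) a)) := fun j => by
          rw [h2, convLp_comm, RightL1Module.ract_conv]
          rfl
        simp only [h5]
        have h6 : Continuous fun b : L1 G => φ (RightL1Module.ract v b) :=
          φ.continuous.comp ((RightL1Module.continuous_ract (G := G) (V := V)).comp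
            (Continuous.prodMk_right v))
        exact (h6.tendsto a).comp (hlim a))
  refine h.isTrivialExtension_of_tendsto hi he hlim hρ hρ0 hρb
    (ContinuousLinearMap.id ℂ Z - i.comp P₀) (fun a z => ?_) (fun z => ?_) fun a y _ => ⟨0, ?_⟩
  · change L1Action.act a z - i (P₀ (L1Action.act a z)) = L1Action.act a (z - i (P₀ z))
    rw [hP₀hom, h.hom_left, L1Module.act_sub]
  · change π (z - i (P₀ z)) = π z
    rw [map_sub, (h.exact _).2 ⟨_, rfl⟩, sub_zero]
  · have h2 : ∀ j, L1Action.act (ContinuousMap.toLp 1 (haarProb G) ℂ a : L1 G)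
        ((ContinuousLinearMap.id ℂ Z - i.comp P₀) (i (y j))) = 0 := fun j => by
      change L1Action.act _ (i (y j) - i (P₀ (i (y j)))) = 0
      rw [L1Module.act_sub, ← h.hom_left, ← h.hom_left, hP₀i, sub_self]
    simp only [h2]
    exact tendsto_const_nhds

end DualModules

theorem mainTheorem4 (G : Type u) [CommGroup G] [TopologicalSpace G]
    [IsTopologicalGroup G] [CompactSpace G] [T2Space G] [MeasurableSpace G] [BorelSpace G] :
    -- duals of right modules
    (∀ (V : Type v) [AddCommGroup V] [Module ℂ V] [TopologicalSpace V] [QuasiNormedSpace V]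
      [RightL1Module G V], ExtEqZero.{w} G (L1 G) (StrongDual ℂ V)) ∧
    -- the spaces `L_p(G)` for `1 < p ≤ ∞`
    (∀ (p : ℝ≥0∞) [Fact (1 ≤ p)], 1 < p → ExtEqZero.{w} G (L1 G) (Lp ℂ p (haarProb G))) ∧
    -- `L₁(G)` and `C(G)`
    ExtEqZero.{w} G (L1 G) (L1 G) ∧
    ExtEqZero.{w} G (L1 G) C(G, ℂ) := by
  exact ⟨fun V _ _ _ _ _ => extEqZero_strongDual, fun p _ _ => extEqZero_Lp p, extEqZero_Lp 1,
    extEqZero_C⟩
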